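/- Let $k\ge 2$ and let $m_1,\dots,m_k$ be positive integers. The cubic caterpillar-Halin graph $H_{m_1,\dots,m_k}$ is the following graph. Put $\ell=m_1+\dots+m_k+k-2$. Draw a horizontal path $u_0,v_1,v_2,\dots,v_\ell,u_{\ell+1}$ in the plane and, at each $v_i$ ($1\le i\le \ell$), attach a pendant edge $v_iu_i$ going vertically up or down, so that, from left to right, the maximal runs of consecutive up or down edges have lengths $m_1,\,m_2+1,\,\dots,\,m_{k-1}+1,\,m_k$ (for $k=2$: $m_1,m_2$), the first run going up. Finally add a cycle through the leaves $u_0,u_1,\dots,u_{\ell+1}$ of this tree, which goes from $u_0$ to $u_{\ell+1}$ through the upper leaves from left to right and returns to $u_0$ through the lower leaves from right to left. The Euler-genus of a closed surface is $2j$ for the orientable surface $O_j$ with $j\ge0$ handles and $k$ for the non-orientable surface $N_k$ with $k\geq 1$ crosscaps. A general rotation system $(\rho,\lambda)$ of a connected graph $G$ consists of a cyclic permutation $\rho_v$ of the edges incident to $v$, for each vertex $v$, and a map $\lambda:E(G)\to\{0,1\}$ telling which edges are twisted ($\lambda(e)=1$); it determines a cellular embedding of $G$ into a closed surface. For a spanning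 tree $T$ of $G$, $(\rho,\lambda)$ is a $T$-rotation system if $\lambda(e)=0$ for all $e\in E(T)$. Let $\varepsilon_{m_1,\dots,m_k}(i)$ be the number of $T$-rotation systems of $H_{m_1,\dots,m_k}$ whose surface (orientable or not) has Euler-genus $i$. Then, for every choice of the spanning tree $T$, $$\varepsilon_{m_1,\dots,m_k}(0)=2\qquad\text{and}\qquad \varepsilon_{m_1,\dots,m_k}(1)=8(m_1+m_2+\dots+m_k+k)-10 .$$ -/

import Mathlib

/-- The closed surfaces: the orientable surface `O_j` with `j ≥ 0` handles and the non-orientable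
surface `N_k` with `k > 0` crosscaps. -/
inductive ClosedSurface : Type
  | orientable (j : ℕ) : ClosedSurface
  | nonorientable (k : ℕ+) : ClosedSurface

namespace ClosedSurface

/-- The Euler-genus: `2 j` for `O_j` and `k` for `N_k`. -/
def eulerGenus : ClosedSurface → ℕ
  | orientable j => 2 * j
  | nonorientable k => k

/-- The Euler characteristic: `2 - 2 j` for `O_j` and `2 - k` for `N_k`. -/
def eulerChar : ClosedSurface → ℤ
  | orientable j => 2 - 2 * (j : ℤ)
  | nonorientable k => 2 - ((k : ℕ) : ℤ)

/-- Orientability of a closed surface. -/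
def IsOrientable : ClosedSurface → Prop
  | orientable _ => True
  | nonorientable _ => False

end ClosedSurface

/-- A general rotation system `(ρ, λ)` of a simple graph `G`.

A dart with initial vertex `v` is an edge incident to `v`, seen from `v`. The permutation `rot` of
the darts is the union of the rotations `ρ_v`: its cycles are exactly the sets of darts with a
common initial vertex, so it consists of one cyclic permutation of the edges incident to `v`
for each vertex `v`. An edge `e` is twisted if `twist e = 1` and untwisted if `twist e = 0`. -/
structure GeneralRotationSystem {V : Type*} (G : SimpleGraph V) where
  /-- the pure rotation system `ρ` -/
  rot : Equiv.Perm G.Dart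
  sameCycle_iff : ∀ d d' : G.Dart, rot.SameCycle d d' ↔ d.fst = d'.fst
  /-- the map `λ` from the edges to `{0, 1}` -/
  twist : G.edgeSet → ZMod 2

namespace GeneralRotationSystem

variable {V : Type*} {G : SimpleGraph V}

/-- A flag `(d, s)` is one of the two sides (long boundary arcs, near the initial vertex of `d`) of
the band that thickens the edge of `d`: as seen from the initial vertex of `d`, the side `s = 0`
faces the next dart `rot d` of the rotation, and the side `s = 1` faces the previous one.
The relation says how a face boundary runs through the thickened graph:
* at a vertex it passes through the corner between `d` and `rot d`;
* along an edge it goes from one end to the other. An untwisted band joins the side `0` at one end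
  to the side `1` at the other end, a twisted band joins sides with the same label. -/
inductive FaceStep (R : GeneralRotationSystem G) : G.Dart × ZMod 2 → G.Dart × ZMod 2 → Prop
  | corner (d : G.Dart) : FaceStep R (d, 0) (R.rot d, 1)
  | edge (d : G.Dart) (s : ZMod 2) :
      FaceStep R (d, s) (d.symm, s + 1 + R.twist ⟨d.edge, d.edge_mem⟩)

/-- The faces: the classes of flags under the equivalence relation generated by `FaceStep`. -/
def Face (R : GeneralRotationSystem G) : Type _ := Quot R.FaceStep

/-- `|V| - |E| + |F|`, the Euler characteristic of the closed surface obtained by thickening `G`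
according to `R` and capping off every boundary component by a disc (for `G` connected and with
at least one edge). -/
noncomputable def eulerChar (R : GeneralRotationSystem G) : ℤ :=
  (Nat.card V : ℤ) - (Nat.card G.edgeSet : ℤ) + (Nat.card R.Face : ℤ)

/-- The surface of `R` is orientable: one can reverse the local orientation at some of the
vertices (those with `σ v = 1`), so that every edge becomes untwisted. -/
def IsOrientable (R : GeneralRotationSystem G) : Prop :=
  ∃ σ : V → ZMod 2, ∀ d : G.Dart, R.twist ⟨d.edge, d.edge_mem⟩ = σ d.fst + σ d.snd

/-- `R` describes an embedding of the connected graph `G` into the closed surface `S`: by the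
classification of surfaces, `S` is recognised by its orientability and Euler characteristic. -/
def EmbedsIn (R : GeneralRotationSystem G) (S : ClosedSurface) : Prop :=
  (R.IsOrientable ↔ S.IsOrientable) ∧ R.eulerChar = S.eulerChar

/-- `R` is a `T`-rotation system: all the edges of `T` are untwisted. -/
def IsTRotationSystem (R : GeneralRotationSystem G) (T : SimpleGraph V) : Prop :=
  ∀ e : G.edgeSet, (e : Sym2 V) ∈ T.edgeSet → R.twist e = 0

end GeneralRotationSystem

/-- `ε_G(i)`: the number of `T`-rotation systems of the connected graph `G`, with spanning tree `T`,
that describe an embedding into a surface of Euler-genus `i`. -/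
noncomputable def embeddingCount {V : Type*} (G T : SimpleGraph V) (i : ℕ) : ℕ :=
  Nat.card {R : GeneralRotationSystem G //
    R.IsTRotationSystem T ∧ ∃ S : ClosedSurface, S.eulerGenus = i ∧ R.EmbedsIn S}

namespace CaterpillarHalin

/-- The vertices of the caterpillar-Halin graph whose spine has `ℓ` vertices: `Sum.inl i` is the
spine vertex `v_{i+1}` and `Sum.inr a` is the leaf `u_a` for `0 ≤ a ≤ ℓ + 1`. -/
abbrev Vertex (ℓ : ℕ) : Type := Fin ℓ ⊕ Fin (ℓ + 2)

/-- The leaf `u_a` lies on the side `c` (`true` is up and `false` is down) of the horizontal path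
from `u_0` through the spine to `u_{ℓ+1}`. The entry `i` of `w` is the direction of the edge pending
from `v_{i+1}`. The leaves `u_0` and `u_{ℓ+1}` are the ends of the path and belong to both sides. -/
def OnSide (w : List Bool) (c : Bool) (a : Fin (w.length + 2)) : Prop :=
  a.val = 0 ∨ a.val = w.length + 1 ∨ ∃ i : Fin w.length, a.val = i.val + 1 ∧ w.get i = c

/-- The edges of the caterpillar-Halin graph, each in one direction: the spine, the edges from the
spine to the leaves, and the outer cycle, which passes from `u_0` to `u_{ℓ+1}` through the upper
leaves and back through the lower leaves, and so joins consecutive leaves of one side. -/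
def EdgeRel (w : List Bool) : Vertex w.length → Vertex w.length → Prop
  | Sum.inl i, Sum.inl j => j.val = i.val + 1
  | Sum.inl i, Sum.inr a => a.val = i.val + 1 ∨ (i.val = 0 ∧ a.val = 0) ∨
      (i.val + 1 = w.length ∧ a.val = w.length + 1)
  | Sum.inr a, Sum.inr b => a < b ∧ ∃ c : Bool, OnSide w c a ∧ OnSide w c b ∧
      ∀ x, a < x → x < b → ¬ OnSide w c x
  | Sum.inr _, Sum.inl _ => False

/-- The caterpillar-Halin graph whose spine carries, from left to right, pending edges in the
directions listed in `w`. -/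
def graph (w : List Bool) : SimpleGraph (Vertex w.length) := SimpleGraph.fromRel (EdgeRel w)

/-- The numbers of maximal consecutive up or down edges of `H_{m_1, …, m_k}`, from left to right:
`m_1, m_2 + 1, …, m_{k-1} + 1, m_k`. -/
def runLength {k : ℕ} (m : Fin k → ℕ) (i : Fin k) : ℕ :=
  if i.val = 0 ∨ i.val + 1 = k then m i else m i + 1

/-- The directions of the pending edges of `H_{m_1, …, m_k}`: runs of the prescribed lengths that
are alternately up and down. -/
def directions {k : ℕ} (m : Fin k → ℕ) : List Bool :=
  (List.finRange k).flatMap fun i => List.replicate (runLength m i) (decide (Even i.val))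

/-- The cubic caterpillar-Halin graph `H_{m_1, …, m_k}` (for `k ≥ 2`). -/
def H {k : ℕ} (m : Fin k → ℕ) : SimpleGraph (Vertex (directions m).length) := graph (directions m)

end CaterpillarHalin

/-! Fix the plane drawing of the cubic graph. A vertex of degree three has only two cyclic orders,
so a general rotation system consists of a set of vertices where the drawing is reversed, together
with the twists. The faces depend only on the relative twists `A`, the twists plus the coboundary of
the reversals (`relTwist`). Every `A : E → ZMod 2` comes from exactly two `T`-rotation systems,
since vanishing twists on `T` determine the reversals up to reversing all vertices at once
(`card_isTRotationSystem`). This is why the choice of `T` does not matter.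

Faces are counted by linear algebra mod 2. A system with `F` faces has `2 ^ F` functions on the
flags that are constant on faces. These correspond to pairs `(y, z)`, where `y` lives on the faces
of the drawing and vanishes on the outer one, `z` lives on the vertices, and the coboundary of `z`
equals `A` times the dual coboundary of `y`. For given `y` such a `z` exists exactly when `y` is in
the kernel of `lap A`, the Laplacian of the dual graph with weights `A` and without the outer row
and column. Hence `F = |Ψ| + 1 - rank (lap A)` for `|Ψ|` inner faces (`card_face`), and Euler's
formula turns the Euler-genus into the rank of `lap A`.

Two inner faces share at most one edge and each inner face has exactly one outer edge, so `A` can be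
read off from `lap A`. Rank 0 means `A = 0`, which gives two systems. Rank 1 means `lap A = x xᵀ`
with `x ≠ 0`; entries at nonadjacent faces vanish, so the support of `x` is a clique of the inner
dual, and every nonempty clique occurs exactly once (`card_rank_lap_eq_one`).

The inner dual of the caterpillar-Halin graph arises from one edge by adding `ℓ` vertices, each
joined to two adjacent earlier ones. It has `1 + 2 + 4ℓ` nonempty cliques (`card_cliques`), so there
are `8ℓ + 6` systems of Euler-genus 1, where `ℓ = ∑ m_i + k - 2`. -/

/-! ### Coboundaries mod 2 -/

/-- The edge underlying a dart. -/
def SimpleGraph.Dart.toEdge {V : Type*} {G : SimpleGraph V} (d : G.Dart) : G.edgeSet :=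
  ⟨d.edge, d.edge_mem⟩

/-- The coboundary of a function on the vertices. -/
def edgeCoboundary {V : Type*} (G : SimpleGraph V) (z : V → ZMod 2) (e : G.edgeSet) : ZMod 2 :=
  Sym2.lift ⟨fun a b => z a + z b, fun _ _ => add_comm _ _⟩ (e : Sym2 V)

section Coboundary

variable {V : Type*} {G : SimpleGraph V}

@[simp] theorem SimpleGraph.Dart.toEdge_symm (d : G.Dart) : d.symm.toEdge = d.toEdge :=
  Subtype.ext d.edge_symm

theorem SimpleGraph.Dart.exists_toEdge_eq (e : G.edgeSet) : ∃ d : G.Dart, d.toEdge = e := by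
  obtain ⟨e, he⟩ := e
  induction e with
  | _ a b => exact ⟨⟨(a, b), he⟩, rfl⟩

@[simp] theorem edgeCoboundary_toEdge (z : V → ZMod 2) (d : G.Dart) :
    edgeCoboundary G z d.toEdge = z d.fst + z d.snd := rfl

/-- A function with zero coboundary on a connected graph is constant. -/
theorem SimpleGraph.Connected.eq_of_adj_eq {β : Type*} (hG : G.Connected) {z : V → β}
    (h : ∀ a b, G.Adj a b → z a = z b) (a b : V) : z a = z b := by
  obtain ⟨p⟩ := hG.preconnected a b
  induction p with
  | nil => rfl
  | cons hadj _ ih => exact (h _ _ hadj).trans ih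

/-- On a tree, every function on the edges is the coboundary of a function on the vertices whose
value at a given vertex is prescribed. -/
theorem SimpleGraph.IsTree.exists_edgeCoboundary_eq [Finite V] (hG : G.IsTree) (r : V)
    (c : ZMod 2) (p : G.edgeSet → ZMod 2) :
    ∃ z : V → ZMod 2, z r = c ∧ edgeCoboundary G z = p := by
  classical
  cases nonempty_fintype V
  let Φ : (V → ZMod 2) → (G.edgeSet → ZMod 2) × ZMod 2 := fun z => (edgeCoboundary G z, z r)
  have hinj : Function.Injective Φ := by
    intro z z' h
    have h1 : edgeCoboundary G z = edgeCoboundary G z' := congrArg Prod.fst h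
    have h2 : z r = z' r := congrArg Prod.snd h
    have h3 : ∀ a b, G.Adj a b → z a + z' a = z b + z' b := fun a b hab => by
      have h4 : z a + z b = z' a + z' b :=
        congrFun h1 (SimpleGraph.Dart.toEdge ⟨(a, b), hab⟩)
      generalize z a = x1 at *
      generalize z b = x2 at *
      generalize z' a = x3 at *
      generalize z' b = x4 at *
      revert x1 x2 x3 x4; decide
    funext v
    have h4 := hG.connected.eq_of_adj_eq h3 v r
    rw [h2, CharTwo.add_self_eq_zero] at h4
    exact CharTwo.add_eq_zero.1 h4
  -- A tree has one more vertex than edges, so the injection `Φ` goes between sets of equal size.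
  have hcard : Fintype.card (V → ZMod 2) = Fintype.card ((G.edgeSet → ZMod 2) × ZMod 2) := by
    have h := hG.card_edgeFinset
    rw [← SimpleGraph.card_edgeSet] at h
    simp only [Fintype.card_prod, Fintype.card_fun, ZMod.card]
    rw [← pow_succ, h]
  obtain ⟨z, hz⟩ := ((Fintype.bijective_iff_injective_and_card Φ).2 ⟨hinj, hcard⟩).2 (p, c)
  exact ⟨z, congrArg Prod.snd hz, congrArg Prod.fst hz⟩

end Coboundary

/-! ### Rotation systems of a cubic graph relative to a fixed rotation -/

/-- A pure rotation system of a cubic graph. -/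
structure CubicRotation {V : Type*} (G : SimpleGraph V) where
  /-- the rotation -/
  rot : Equiv.Perm G.Dart
  fst_rot : ∀ d, (rot d).fst = d.fst
  star : ∀ d d' : G.Dart, d'.fst = d.fst → d' = d ∨ d' = rot d ∨ d' = rot.symm d
  rot_ne : ∀ d, rot d ≠ d
  rot_ne_symm : ∀ d, rot d ≠ rot.symm d
  exists_dart : ∀ v, ∃ d : G.Dart, d.fst = v

namespace CubicRotation

variable {V : Type*} {G : SimpleGraph V} (M : CubicRotation G)

theorem fst_rot_symm (d : G.Dart) : (M.rot.symm d).fst = d.fst := by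
  conv_rhs => rw [← M.rot.apply_symm_apply d, M.fst_rot]

/-- There are exactly three darts at a vertex, so the rotation has order three. -/
theorem rot_rot (d : G.Dart) : M.rot (M.rot d) = M.rot.symm d := by
  rcases M.star d (M.rot (M.rot d)) (by simp [M.fst_rot]) with h | h | h
  · exact absurd (M.rot.injective (by simpa using h)) (M.rot_ne_symm d)
  · exact absurd (M.rot.injective h) (M.rot_ne d)
  · exact h

/-- The rotation that is reversed at the vertices with `s v = 1`. -/
def flipRot (s : V → ZMod 2) (d : G.Dart) : G.Dart :=
  if s d.fst = 0 then M.rot d else M.rot.symm d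

theorem fst_flipRot (s : V → ZMod 2) (d : G.Dart) : (M.flipRot s d).fst = d.fst := by
  unfold flipRot; split_ifs
  · exact M.fst_rot d
  · exact M.fst_rot_symm d

/-- `flipRot` as a permutation. -/
def flipPerm (s : V → ZMod 2) : Equiv.Perm G.Dart where
  toFun := M.flipRot s
  invFun := fun d => if s d.fst = 0 then M.rot.symm d else M.rot d
  left_inv d := by
    by_cases h : s d.fst = 0 <;> simp [M.fst_flipRot, h] <;> simp [flipRot, h]
  right_inv d := by
    by_cases h : s d.fst = 0 <;> simp [flipRot, h, M.fst_rot, M.fst_rot_symm]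

@[simp] theorem flipPerm_apply (s : V → ZMod 2) (d : G.Dart) :
    M.flipPerm s d = M.flipRot s d := rfl

theorem sameCycle_flipPerm (s : V → ZMod 2) (d d' : G.Dart) :
    (M.flipPerm s).SameCycle d d' ↔ d.fst = d'.fst := by
  constructor
  · rintro ⟨i, rfl⟩
    have key : ∀ (n : ℕ) (e : G.Dart), (((M.flipPerm s) ^ n) e).fst = e.fst := by
      intro n
      induction n with
      | zero => intro e; rfl
      | succ n ih => intro e; rw [pow_succ, Equiv.Perm.mul_apply, ih]; exact M.fst_flipRot s e
    cases i with
    | ofNat n => exact (key n d).symm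
    | negSucc n =>
      have h := key (n + 1) (((M.flipPerm s) ^ (Int.negSucc n)) d)
      rwa [← Equiv.Perm.mul_apply, zpow_negSucc, mul_inv_cancel, Equiv.Perm.one_apply] at h
  · intro h
    rcases M.star d d' h.symm with rfl | rfl | rfl
    · exact Equiv.Perm.SameCycle.refl _ _
    · by_cases hs : s d.fst = 0
      · exact ⟨1, by simp [flipRot, hs]⟩
      · refine ⟨-1, ?_⟩
        rw [zpow_neg_one, Equiv.Perm.inv_eq_iff_eq]
        simp [flipRot, hs, M.fst_rot]
    · by_cases hs : s d.fst = 0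
      · refine ⟨-1, ?_⟩
        rw [zpow_neg_one, Equiv.Perm.inv_eq_iff_eq]
        simp [flipRot, hs, M.fst_rot_symm]
      · exact ⟨1, by simp [flipRot, hs]⟩

/-- The general rotation system obtained from reversals and twists. -/
def system (s : V → ZMod 2) (t : G.edgeSet → ZMod 2) : GeneralRotationSystem G where
  rot := M.flipPerm s
  sameCycle_iff := M.sameCycle_flipPerm s
  twist := t

variable (R : GeneralRotationSystem G)

theorem fst_system_rot (d : G.Dart) : (R.rot d).fst = d.fst :=
  ((R.sameCycle_iff d (R.rot d)).1 ⟨1, by simp⟩).symm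

theorem system_rot_ne (M : CubicRotation G) (R : GeneralRotationSystem G) (d : G.Dart) :
    R.rot d ≠ d := by
  intro h
  have h1 : R.rot.SameCycle d (M.rot d) := (R.sameCycle_iff _ _).2 (M.fst_rot d).symm
  exact M.rot_ne d ((Equiv.Perm.SameCycle.eq_of_left h1 h).symm)

theorem system_rot_eq (d : G.Dart) : R.rot d = M.rot d ∨ R.rot d = M.rot.symm d := by
  rcases M.star d (R.rot d) (fst_system_rot R d) with h | h
  · exact absurd h (M.system_rot_ne R d)
  · exact h

/-- Otherwise `R` would exchange `d` and `M.rot d`. Both values open to the third dart would then be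
taken already. -/
theorem system_rot_rot {d : G.Dart} (h : R.rot d = M.rot d) :
    R.rot (M.rot d) = M.rot (M.rot d) := by
  rcases M.system_rot_eq R (M.rot d) with h1 | h1
  · exact h1
  · rw [Equiv.symm_apply_apply] at h1
    obtain ⟨c, rfl⟩ := M.rot.surjective d
    rcases M.system_rot_eq R c with h2 | h2
    · have h3 := R.rot.injective (h2.trans h1.symm)
      rw [M.rot_rot] at h3
      exact absurd ((Equiv.eq_symm_apply _).1 h3) (M.rot_ne c)
    · rw [← M.rot_rot, ← h] at h2
      exact absurd (R.rot.injective h2).symm (M.rot_ne c)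

theorem system_rot_orient {d e : G.Dart} (hde : d.fst = e.fst) (h : R.rot d = M.rot d) :
    R.rot e = M.rot e := by
  have h1 := M.system_rot_rot R h
  have h2 := M.system_rot_rot R h1
  rw [M.rot_rot] at h2
  rcases M.star d e hde.symm with rfl | rfl | rfl
  exacts [h, h1, h2]

open Classical in
/-- The vertices at which `R` reverses the rotation of `M` have the value `1`. -/
noncomputable def orient (v : V) : ZMod 2 :=
  if ∀ d : G.Dart, d.fst = v → R.rot d = M.rot d then 0 else 1

theorem rot_eq_flipRot (d : G.Dart) : R.rot d = M.flipRot (M.orient R) d := by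
  unfold flipRot orient
  by_cases h : R.rot d = M.rot d
  · rw [if_pos (if_pos fun e he => M.system_rot_orient R he.symm h), h]
  · rw [if_neg, (M.system_rot_eq R d).resolve_left h]
    rw [if_neg fun h1 => h (h1 d rfl)]
    exact one_ne_zero

/-- With `system_orient_twist`, this identifies general rotation systems with pairs of reversals and
twists. -/
theorem orient_system (s : V → ZMod 2) (t : G.edgeSet → ZMod 2) :
    M.orient (M.system s t) = s := by
  funext v
  obtain ⟨d, rfl⟩ := M.exists_dart v
  have h := M.rot_eq_flipRot (M.system s t) d
  have h1 : ∀ x : ZMod 2, x ≠ 0 → x = 1 := by decide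
  change M.flipRot s d = _ at h
  unfold flipRot at h
  have h2 := M.rot_ne_symm d
  by_cases hs : s d.fst = 0 <;> by_cases ho : M.orient (M.system s t) d.fst = 0
  · rw [hs, ho]
  · rw [if_pos hs, if_neg ho] at h; exact absurd h h2
  · rw [if_neg hs, if_pos ho] at h; exact absurd h.symm h2
  · rw [h1 _ hs, h1 _ ho]

theorem system_orient_twist : M.system (M.orient R) R.twist = R := by
  have h : (M.system (M.orient R) R.twist).rot = R.rot :=
    Equiv.ext fun d => (M.rot_eq_flipRot R d).symm
  cases R
  simp only [system, GeneralRotationSystem.mk.injEq] at h ⊢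
  exact ⟨h, trivial⟩

/-- The twists of `R` after the rotations that differ from `M` have been reversed. -/
noncomputable def relTwist (e : G.edgeSet) : ZMod 2 := R.twist e + edgeCoboundary G (M.orient R) e

/-- Two `T`-rotation systems belong to every choice of the relative twists. -/
theorem card_isTRotationSystem [Finite V] {T : SimpleGraph V} (hle : T ≤ G) (hT : T.IsTree)
    (P : (G.edgeSet → ZMod 2) → Prop) :
    Nat.card {R : GeneralRotationSystem G // R.IsTRotationSystem T ∧ P (M.relTwist R)} =
      2 * Nat.card {A : G.edgeSet → ZMod 2 // P A} := by
  classical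
  obtain ⟨r⟩ := hT.connected.nonempty
  let Φ : {R : GeneralRotationSystem G // R.IsTRotationSystem T ∧ P (M.relTwist R)} →
      ZMod 2 × {A : G.edgeSet → ZMod 2 // P A} :=
    fun R => (M.orient R.1 r, ⟨M.relTwist R.1, R.2.2⟩)
  have hΦ : Function.Bijective Φ := by
    constructor
    · rintro ⟨R, hR, hP⟩ ⟨R', hR', hP'⟩ h
      have h1 : M.orient R r = M.orient R' r := congrArg Prod.fst h
      have h2 : M.relTwist R = M.relTwist R' := congrArg (fun x => x.2.1) h
      -- On `T` the twists vanish and the relative twist is just the coboundary of the reversals.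
      -- Equal relative twists therefore make the two reversal functions differ by a constant, and
      -- the value at `r` removes it.
      have h3 : ∀ a b, T.Adj a b →
          M.orient R a + M.orient R' a = M.orient R b + M.orient R' b := by
        intro a b hab
        have hd : ((SimpleGraph.Dart.toEdge ⟨(a, b), hle hab⟩ : G.edgeSet) : Sym2 V) ∈
          T.edgeSet := hab
        have h4 := congrFun h2 (SimpleGraph.Dart.toEdge ⟨(a, b), hle hab⟩)
        simp only [relTwist, edgeCoboundary_toEdge] at h4
        rw [hR _ hd, hR' _ hd] at h4
        generalize M.orient R a = x1 at *
        generalize M.orient R b = x2 at *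
        generalize M.orient R' a = x3 at *
        generalize M.orient R' b = x4 at *
        revert x1 x2 x3 x4; decide
      have h5 : M.orient R = M.orient R' := by
        funext v
        have h4 := hT.connected.eq_of_adj_eq h3 v r
        rw [h1, CharTwo.add_self_eq_zero] at h4
        exact CharTwo.add_eq_zero.1 h4
      have h6 : R.twist = R'.twist := by
        funext e
        have := congrFun h2 e
        simp only [relTwist, h5] at this
        exact add_right_cancel this
      apply Subtype.ext
      change R = R'
      rw [← M.system_orient_twist R, ← M.system_orient_twist R', h5, h6]
    · rintro ⟨c, A, hA⟩
      -- The twists have to be `A` plus the coboundary of the reversals `z`; they vanish on `T` when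
      -- `z` has coboundary `A` there.
      obtain ⟨z, hz, hp⟩ := hT.exists_edgeCoboundary_eq r c
        (fun e => A ⟨e.1, SimpleGraph.edgeSet_mono hle e.2⟩)
      have hrel : M.relTwist (M.system z (A + edgeCoboundary G z)) = A := by
        funext e
        rw [relTwist, orient_system]
        exact CharTwo.add_cancel_right _ _
      refine ⟨⟨M.system z (A + edgeCoboundary G z), ?_, by rwa [hrel]⟩, ?_⟩
      · intro e he
        have h := congrFun hp ⟨e, he⟩
        change A e + edgeCoboundary G z e = 0
        exact CharTwo.add_eq_zero.2 h.symm
      · simp only [Φ, Prod.mk.injEq, Subtype.mk.injEq]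
        exact ⟨by rw [orient_system, hz], hrel⟩
  rw [Nat.card_eq_of_bijective Φ hΦ, Nat.card_prod, Nat.card_zmod]

end CubicRotation

/-! ### Plane cubic maps and duality of cuts and cycles mod 2 -/

/-- A plane embedding of a cubic graph, given by a rotation and a labelling of the faces: the face
`none` is distinguished (the outer face), and the other faces are labelled by `Ψ`. The edges
not on the outer face form a forest. -/
structure CubicPlaneMap {V : Type*} (G : SimpleGraph V) (Ψ : Type*) extends CubicRotation G where
  /-- the face on the left of a dart -/
  left : G.Dart → Option Ψ
  -- The corner between `d` and `rot d` lies in a single face.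
  left_rot : ∀ d, left (rot d).symm = left d
  left_ne : ∀ d, left d ≠ left d.symm
  left_inj : ∀ d d', left d = left d' → left d.symm = left d'.symm → d = d'
  outer : ∀ ψ, ∃ d, left d = some ψ ∧ left d.symm = none
  -- Being a forest is expressed cohomologically: every function on these edges is a coboundary.
  forest : ∀ p : G.edgeSet → ZMod 2, ∃ z : V → ZMod 2, ∀ d, left d ≠ none →
    left d.symm ≠ none → p d.toEdge = edgeCoboundary G z d.toEdge

/-- The extension of a function by zero at `none`. -/
def Option.extendZero {Ψ : Type*} (y : Ψ → ZMod 2) (o : Option Ψ) : ZMod 2 := o.elim 0 y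

@[simp] theorem Option.extendZero_none {Ψ : Type*} (y : Ψ → ZMod 2) :
    Option.extendZero y none = 0 := rfl

@[simp] theorem Option.extendZero_some {Ψ : Type*} (y : Ψ → ZMod 2) (ψ : Ψ) :
    Option.extendZero y (some ψ) = y ψ := rfl

theorem SimpleGraph.sum_dart_eq_sum_edge {V : Type*} {G : SimpleGraph V} [Fintype G.Dart]
    [Fintype G.edgeSet] {F : G.Dart → ZMod 2} {E : G.edgeSet → ZMod 2}
    (h : ∀ d, F d + F d.symm = E d.toEdge) : ∑ d, F d = ∑ e, E e := by
  classical
  rw [← Finset.sum_fiberwise_of_maps_to (t := Finset.univ) (g := SimpleGraph.Dart.toEdge)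
    (fun _ _ => Finset.mem_univ _)]
  refine Finset.sum_congr rfl fun e _ => ?_
  obtain ⟨d, rfl⟩ := SimpleGraph.Dart.exists_toEdge_eq e
  have h1 : Finset.univ.filter (fun d' : G.Dart => d'.toEdge = d.toEdge) = {d, d.symm} := by
    ext d'
    simp only [Finset.mem_filter, Finset.mem_univ, true_and, Finset.mem_insert,
      Finset.mem_singleton]
    rw [← SimpleGraph.dart_edge_eq_iff]
    exact Subtype.ext_iff
  rw [h1, Finset.sum_pair d.symm_ne.symm, h]

namespace CubicPlaneMap

variable {V Ψ : Type*} {G : SimpleGraph V} (M : CubicPlaneMap G Ψ)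

/-- The coboundary in the dual graph of a function on the faces that vanishes at the outer face. -/
noncomputable def dualCob (y : Ψ → ZMod 2) (e : G.edgeSet) : ZMod 2 :=
  Option.extendZero y (M.left (SimpleGraph.Dart.exists_toEdge_eq e).choose) +
    Option.extendZero y (M.left (SimpleGraph.Dart.exists_toEdge_eq e).choose.symm)

theorem dualCob_toEdge (y : Ψ → ZMod 2) (d : G.Dart) :
    M.dualCob y d.toEdge =
      Option.extendZero y (M.left d) + Option.extendZero y (M.left d.symm) := by
  unfold dualCob
  have h := (SimpleGraph.Dart.exists_toEdge_eq d.toEdge).choose_spec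
  generalize (SimpleGraph.Dart.exists_toEdge_eq d.toEdge).choose = c at *
  rcases (SimpleGraph.dart_edge_eq_iff c d).1 (congrArg Subtype.val h) with rfl | rfl
  · rfl
  · rw [SimpleGraph.Dart.symm_symm, add_comm]

variable [Fintype V]

open Classical in
theorem sum_mul_left_rot (z : V → ZMod 2) (F : G.Dart → ZMod 2) :
    ∑ d, z d.fst * F (M.rot d) = ∑ d, z d.fst * F d := by
  rw [← Equiv.sum_comp M.rot fun d => z d.fst * F d]
  simp [M.fst_rot]

open Classical in
theorem sum_face_fst_eq_sum_face_snd (y : Option Ψ → ZMod 2) (t : V → ZMod 2) :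
    ∑ d, y (M.left d) * t d.fst = ∑ d, y (M.left d) * t d.snd := by
  -- `κ` moves back by one dart along the boundary of the face on the left: it keeps that face, and
  -- `κ d` ends where `d` begins.
  let κ : Equiv.Perm G.Dart := M.rot.trans (SimpleGraph.Dart.symm_involutive.toPerm _)
  rw [← Equiv.sum_comp κ fun d => y (M.left d) * t d.snd]
  refine Finset.sum_congr rfl fun d _ => ?_
  have h : κ d = (M.rot d).symm := rfl
  rw [h, M.left_rot]
  congr 2
  exact (M.fst_rot d).symm

-- Face boundaries are closed walks, so a coboundary sums to zero around each of them.
open Classical in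
theorem sum_face_edgeCoboundary (y : Option Ψ → ZMod 2) (t : V → ZMod 2) :
    ∑ d : G.Dart, y (M.left d) * edgeCoboundary G t d.toEdge = 0 := by
  simp only [edgeCoboundary_toEdge, mul_add, Finset.sum_add_distrib]
  rw [M.sum_face_fst_eq_sum_face_snd, CharTwo.add_self_eq_zero]

-- Going round a vertex, every face is met once as a left and once as a right face, so the
-- contributions cancel.
open Classical in
theorem sum_star_dualCob (y : Ψ → ZMod 2) (z : V → ZMod 2) :
    ∑ d : G.Dart, z d.fst * M.dualCob y d.toEdge = 0 := by
  simp only [dualCob_toEdge, mul_add, Finset.sum_add_distrib]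
  rw [← M.sum_mul_left_rot z fun d => Option.extendZero y (M.left d.symm)]
  simp only [M.left_rot, CharTwo.add_self_eq_zero]

/-- Every even set of edges is a dual coboundary. -/
theorem exists_dualCob_eq (h : G.edgeSet → ZMod 2)
    (hz : ∀ z : V → ZMod 2, (open Classical in ∑ d : G.Dart, z d.fst * h d.toEdge) = 0) :
    ∃ y, M.dualCob y = h := by
  classical
  choose o ho ho' using M.outer
  -- As `y` is zero on the outer face, its value on `ψ` is forced by the outer edge of `ψ`. The
  -- remainder `q` is an even function supported on the forest.
  let y : Ψ → ZMod 2 := fun ψ => h (o ψ).toEdge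
  let q := fun e => h e + M.dualCob y e
  have hq0 : ∀ d : G.Dart, M.left d.symm = none → q d.toEdge = 0 := by
    intro d hd
    obtain ⟨ψ, hψ⟩ := Option.ne_none_iff_exists'.1 fun h0 => M.left_ne d (h0.trans hd.symm)
    obtain rfl : d = o ψ := M.left_inj _ _ (by rw [hψ, ho]) (by rw [hd, ho'])
    simp [q, dualCob_toEdge, ho, ho', y, CharTwo.add_self_eq_zero]
  have hqz : ∀ z : V → ZMod 2, ∑ d : G.Dart, z d.fst * q d.toEdge = 0 := by
    intro z
    simp only [q, mul_add, Finset.sum_add_distrib, sum_star_dualCob, add_zero]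
    convert hz z
  refine ⟨y, funext fun e => (CharTwo.add_eq_zero.1 ?_).symm⟩
  change q e = 0
  -- Pairing `q` with a vertex function whose coboundary on the forest is the indicator of `e`
  -- isolates `q e`.
  obtain ⟨z, hzp⟩ := M.forest (fun e' => if e' = e then 1 else 0)
  have h1 := hqz z
  rw [SimpleGraph.sum_dart_eq_sum_edge (E := fun e' => if e' = e then q e' else 0)] at h1
  · simpa using h1
  · intro d
    by_cases h1 : M.left d.symm = none
    · simp [hq0 d h1]
    by_cases h2 : M.left d = none
    · have := hq0 d.symm (by rwa [SimpleGraph.Dart.symm_symm])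
      rw [SimpleGraph.Dart.toEdge_symm] at this
      simp [this]
    have h3 := hzp d h2 h1
    rw [edgeCoboundary_toEdge] at h3
    rw [SimpleGraph.Dart.toEdge_symm, ← add_mul]
    change (z d.fst + z d.snd) * _ = _
    rw [← h3, ite_mul, one_mul, zero_mul]

/-- A function on the edges that sums to zero around every inner face is a coboundary. -/
theorem exists_edgeCoboundary_eq (p : G.edgeSet → ZMod 2)
    (hp : ∀ y : Ψ → ZMod 2,
      (open Classical in ∑ d : G.Dart, Option.extendZero y (M.left d) * p d.toEdge) = 0) :
    ∃ z, edgeCoboundary G z = p := by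
  classical
  obtain ⟨z, hz⟩ := M.forest p
  let q := fun e => p e + edgeCoboundary G z e
  have hqy : ∀ y : Ψ → ZMod 2,
      ∑ d : G.Dart, Option.extendZero y (M.left d) * q d.toEdge = 0 := by
    intro y
    simp only [q, mul_add, Finset.sum_add_distrib, sum_face_edgeCoboundary, add_zero]
    convert hp y
  have hq0 : ∀ d : G.Dart, M.left d ≠ none → M.left d.symm ≠ none → q d.toEdge = 0 :=
    fun d h1 h2 => CharTwo.add_eq_zero.2 (hz d h1 h2)
  have hq1 : ∀ d : G.Dart, M.left d.symm = none → q d.toEdge = 0 := by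
    intro d hd
    obtain ⟨ψ, hψ⟩ := Option.ne_none_iff_exists'.1 fun h0 => M.left_ne d (h0.trans hd.symm)
    -- Around the face `ψ` only its one outer edge can contribute to the sum of `q`.
    have h1 := hqy fun a => if a = ψ then 1 else 0
    rw [Finset.sum_eq_single d] at h1
    · simpa [hψ] using h1
    · intro d' _ hd'
      rcases h2 : M.left d' with _ | a
      · simp
      by_cases ha : a = ψ
      · subst ha
        rw [hq0 d' (by simp [h2]) fun h3 => hd' (M.left_inj _ _ (h2.trans hψ.symm)
          (h3.trans hd.symm)), mul_zero]
      · simp [ha]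
    · simp
  refine ⟨z, funext fun e => (CharTwo.add_eq_zero.1 ?_).symm⟩
  change q e = 0
  obtain ⟨d, rfl⟩ := SimpleGraph.Dart.exists_toEdge_eq e
  by_cases h1 : M.left d.symm = none
  · exact hq1 d h1
  by_cases h2 : M.left d = none
  · rw [← SimpleGraph.Dart.toEdge_symm]
    exact hq1 _ (by rwa [SimpleGraph.Dart.symm_symm])
  exact hq0 d h2 h1

end CubicPlaneMap

/-! ### Faces counted by invariant functions on the flags -/

namespace GeneralRotationSystem

variable {V : Type*} {G : SimpleGraph V}

/-- The number of functions on the flags that are constant on the faces. -/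
theorem two_pow_card_face [Finite V] (R : GeneralRotationSystem G) :
    2 ^ Nat.card R.Face =
      Nat.card {f : G.Dart × ZMod 2 → ZMod 2 // ∀ a b, R.FaceStep a b → f a = f b} := by
  classical
  cases nonempty_fintype V
  have : Finite R.Face := Quot.finite _
  let e : {f : G.Dart × ZMod 2 → ZMod 2 // ∀ a b, R.FaceStep a b → f a = f b} ≃
      (R.Face → ZMod 2) :=
    { toFun := fun f => Quot.lift f.1 f.2
      invFun := fun g => ⟨fun a => g (Quot.mk _ a), fun _ _ h => congrArg g (Quot.sound h)⟩
      left_inv := fun f => rfl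
      right_inv := fun g => by funext a; induction a using Quot.ind; rfl }
  rw [Nat.card_congr e, Nat.card_fun, Nat.card_zmod]

end GeneralRotationSystem

theorem ZMod.two_eq_or_eq_add_one (s t : ZMod 2) : s = t ∨ s = t + 1 := by
  revert s t; decide

theorem ZMod.two_ne_add_one (s : ZMod 2) : s + 1 ≠ s := by
  revert s; decide

namespace CubicPlaneMap

variable {V Ψ : Type*} {G : SimpleGraph V} (M : CubicPlaneMap G Ψ)

/-- The pairs of a function on the faces and a function on the vertices that parametrize
the functions that are constant on the faces of a general rotation system. -/
def potentials (A : G.edgeSet → ZMod 2) : Set ((Ψ → ZMod 2) × (V → ZMod 2)) :=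
  {x | ∀ e, edgeCoboundary G x.2 e = A e * M.dualCob x.1 e}

theorem potentials_dart {A : G.edgeSet → ZMod 2} {x : (Ψ → ZMod 2) × (V → ZMod 2)}
    (hx : x ∈ M.potentials A) (d : G.Dart) : x.2 d.fst + x.2 d.snd = A d.toEdge *
      (Option.extendZero x.1 (M.left d) + Option.extendZero x.1 (M.left d.symm)) := by
  rw [← dualCob_toEdge, ← edgeCoboundary_toEdge, hx]

/-- The function on the flags that belongs to a potential. -/
def flagFun (s : V → ZMod 2) (x : (Ψ → ZMod 2) × (V → ZMod 2)) (a : G.Dart × ZMod 2) : ZMod 2 :=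
  x.2 a.1.fst + if a.2 = s a.1.fst then Option.extendZero x.1 (M.left a.1)
    else Option.extendZero x.1 (M.left a.1.symm)

/-- A flag gets the value of its vertex plus the value of the plane face on its side of the edge.
The two flags of a corner lie in the same plane face, whether or not the vertex is reversed. -/
theorem flagFun_corner (R : GeneralRotationSystem G) (x : (Ψ → ZMod 2) × (V → ZMod 2))
    (d : G.Dart) : M.flagFun (M.orient R) x (d, 0) = M.flagFun (M.orient R) x (R.rot d, 1) := by
  rw [M.rot_eq_flipRot]
  unfold flagFun
  simp only [CubicRotation.fst_flipRot]
  congr 1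
  unfold CubicRotation.flipRot
  rcases ZMod.two_eq_or_eq_add_one (M.orient R d.fst) 0 with h | h
  · simp [h, M.left_rot]
  · have h1 := M.left_rot (M.rot.symm d)
    rw [Equiv.apply_symm_apply] at h1
    simp [h, h1]

/-- With relative twist 0 the plane face is kept along the edge, so the vertex values must agree.
With relative twist 1 the boundary crosses to the other plane face, and the vertex values must
differ by the dual coboundary. This is the equation of `potentials`. -/
theorem flagFun_edge (R : GeneralRotationSystem G) {x : (Ψ → ZMod 2) × (V → ZMod 2)}
    (hx : x ∈ M.potentials (M.relTwist R)) (d : G.Dart) (s : ZMod 2) :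
    M.flagFun (M.orient R) x (d, s) =
      M.flagFun (M.orient R) x (d.symm, s + 1 + R.twist d.toEdge) := by
  have h := M.potentials_dart hx d
  have h1 : M.relTwist R d.toEdge =
      R.twist d.toEdge + (M.orient R d.fst + M.orient R d.snd) := rfl
  rw [h1] at h
  have h2 : d.symm.fst = d.snd := rfl
  simp only [flagFun, h2, SimpleGraph.Dart.symm_symm]
  generalize x.2 d.fst = x1 at *
  generalize x.2 d.snd = x2 at *
  generalize Option.extendZero x.1 (M.left d) = y1 at *
  generalize Option.extendZero x.1 (M.left d.symm) = y2 at *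
  generalize R.twist d.toEdge = t at *
  generalize M.orient R d.fst = o1 at *
  generalize M.orient R d.snd = o2 at *
  clear h1 h2 hx
  revert x1 x2 y1 y2 t o1 o2 s
  decide

theorem flagFun_invariant (R : GeneralRotationSystem G) {x : (Ψ → ZMod 2) × (V → ZMod 2)}
    (hx : x ∈ M.potentials (M.relTwist R)) (a b : G.Dart × ZMod 2) (h : R.FaceStep a b) :
    M.flagFun (M.orient R) x a = M.flagFun (M.orient R) x b := by
  cases h with
  | corner d => exact M.flagFun_corner R x d
  | edge d s => exact M.flagFun_edge R hx d s

/-- At the outer edge of `ψ` the two flags differ by `x.1 ψ`, since the outer face has value zero.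
Once `x.1` is known, any flag at a vertex gives `x.2` there. -/
theorem flagFun_injective (s : V → ZMod 2) : Function.Injective (M.flagFun s) := by
  intro x x' h
  have h1 : x.1 = x'.1 := by
    funext ψ
    obtain ⟨d, hd, hd'⟩ := M.outer ψ
    have h2 := congrFun h (d, s d.fst)
    have h3 := congrFun h (d, s d.fst + 1)
    simp only [flagFun, hd, hd', if_true, ZMod.two_ne_add_one, if_false, Option.extendZero_some,
      Option.extendZero_none, add_zero] at h2 h3
    rw [h3] at h2
    exact add_left_cancel h2
  refine Prod.ext h1 (funext fun v => ?_)
  obtain ⟨d, rfl⟩ := M.exists_dart v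
  have h2 := congrFun h (d, 0)
  simp only [flagFun, h1] at h2
  exact add_right_cancel h2

/-- The corner relation in terms of the rotation of `M`, so that reversed vertices need no separate
treatment later. -/
theorem invariant_corner (R : GeneralRotationSystem G) {f : G.Dart × ZMod 2 → ZMod 2}
    (hf : ∀ a b, R.FaceStep a b → f a = f b) (d : G.Dart) :
    f (M.rot d, M.orient R d.fst + 1) = f (d, M.orient R d.fst) := by
  have h := M.rot_eq_flipRot R d
  have h' := M.rot_eq_flipRot R (M.rot d)
  unfold CubicRotation.flipRot at h h'
  rw [M.fst_rot] at h'
  rcases ZMod.two_eq_or_eq_add_one (M.orient R d.fst) 0 with h1 | h1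
  · rw [h1] at h ⊢
    rw [hf _ _ (.corner d), h]
    rfl
  · rw [h1] at h' ⊢
    have h2 := hf _ _ (.corner (M.rot d))
    rw [h', if_neg (by decide), Equiv.symm_apply_apply] at h2
    exact h2

/-- The sum of an invariant `f` over the two sides of an edge depends only on the edge. By the
corner relation it is even at every vertex, hence a dual coboundary of some `y`. Removing `y` from
`f` leaves a function that is constant at each vertex, which gives `z`. -/
theorem flagFun_surjective [Finite V] (R : GeneralRotationSystem G)
    {f : G.Dart × ZMod 2 → ZMod 2} (hf : ∀ a b, R.FaceStep a b → f a = f b) :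
    ∃ x ∈ M.potentials (M.relTwist R), M.flagFun (M.orient R) x = f := by
  classical
  cases nonempty_fintype V
  let h : G.edgeSet → ZMod 2 := fun e =>
    f ((SimpleGraph.Dart.exists_toEdge_eq e).choose, 0) +
      f ((SimpleGraph.Dart.exists_toEdge_eq e).choose, 1)
  have hfe : ∀ d s, f (d, s) = f (d.symm, s + 1 + R.twist d.toEdge) :=
    fun d s => hf _ _ (.edge d s)
  have hsum : ∀ (d : G.Dart) (s t : ZMod 2), s ≠ t → f (d, s) + f (d, t) = f (d, 0) + f (d, 1) := by
    intro d s t hst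
    have : (s = 0 ∧ t = 1) ∨ (s = 1 ∧ t = 0) := by revert s t; decide
    rcases this with ⟨rfl, rfl⟩ | ⟨rfl, rfl⟩
    · rfl
    · exact add_comm _ _
  have hh : ∀ d : G.Dart, h d.toEdge = f (d, 0) + f (d, 1) := by
    intro d
    have h1 := (SimpleGraph.Dart.exists_toEdge_eq d.toEdge).choose_spec
    change f ((SimpleGraph.Dart.exists_toEdge_eq d.toEdge).choose, 0) +
      f ((SimpleGraph.Dart.exists_toEdge_eq d.toEdge).choose, 1) = _
    generalize (SimpleGraph.Dart.exists_toEdge_eq d.toEdge).choose = c at *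
    rcases (SimpleGraph.dart_edge_eq_iff c d).1 (congrArg Subtype.val h1) with rfl | rfl
    · rfl
    · rw [hfe d 0, hfe d 1]
      exact (hsum _ _ _ fun h2 =>
        zero_ne_one (α := ZMod 2) (add_right_cancel (add_right_cancel h2))).symm
  have hh' : ∀ d : G.Dart, h d.toEdge =
      f (d, M.orient R d.fst) + f (d, M.orient R d.fst + 1) := fun d => by
    rw [hh, hsum _ _ _ (ZMod.two_ne_add_one _).symm]
  have hc := M.invariant_corner R hf
  -- At each vertex the two terms of `h` have the same sum, because the rotation carries one to the
  -- other.
  obtain ⟨y, hy⟩ := M.exists_dualCob_eq h (by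
    intro z
    have h1 := M.sum_mul_left_rot z fun d => f (d, M.orient R d.fst + 1)
    simp only [M.fst_rot, hc] at h1
    simp only [hh', mul_add, Finset.sum_add_distrib, h1, CharTwo.add_self_eq_zero])
  let g : G.Dart → ZMod 2 := fun d =>
    f (d, M.orient R d.fst) + Option.extendZero y (M.left d)
  have hfg : ∀ d, f (d, M.orient R d.fst + 1) = g d + Option.extendZero y (M.left d.symm) := by
    intro d
    have h1 := hh' d
    rw [← hy, dualCob_toEdge] at h1
    simp only [g]
    generalize f (d, M.orient R d.fst) = x1 at *
    generalize f (d, M.orient R d.fst + 1) = x2 at *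
    generalize Option.extendZero y (M.left d) = x3 at *
    generalize Option.extendZero y (M.left d.symm) = x4 at *
    clear hc
    revert x1 x2 x3 x4; decide
  have hg : ∀ d, g (M.rot d) = g d := by
    intro d
    have h1 := hfg (M.rot d)
    rw [M.fst_rot, hc, M.left_rot] at h1
    simp only [g] at h1 ⊢
    rw [h1, CharTwo.add_cancel_right]
  choose o ho using M.exists_dart
  let z : V → ZMod 2 := fun v => g (o v)
  have hz : ∀ d, z d.fst = g d := by
    intro d
    have h1 : ∀ e, g (M.rot.symm e) = g e := fun e => by
      rw [← hg (M.rot.symm e), Equiv.apply_symm_apply]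
    rcases M.star (o d.fst) d (ho _).symm with h2 | h2 | h2
    · exact congrArg g h2.symm
    · exact (hg (o d.fst)).symm.trans (congrArg g h2.symm)
    · exact (h1 (o d.fst)).symm.trans (congrArg g h2.symm)
  have hfz : M.flagFun (M.orient R) (y, z) = f := by
    funext ⟨d, s⟩
    simp only [flagFun, hz]
    split_ifs with h1
    · rw [h1]; exact CharTwo.add_cancel_right _ _
    · rw [(ZMod.two_eq_or_eq_add_one s _).resolve_left h1, hfg]
  refine ⟨(y, z), fun e => ?_, hfz⟩
  obtain ⟨d, rfl⟩ := SimpleGraph.Dart.exists_toEdge_eq e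
  have h1 : M.relTwist R d.toEdge =
      R.twist d.toEdge + (M.orient R d.fst + M.orient R d.snd) := rfl
  have h2 := hfe d 0
  have h3 : d.symm.fst = d.snd := rfl
  rw [← hfz] at h2
  rw [edgeCoboundary_toEdge, dualCob_toEdge, h1]
  simp only [flagFun, h3, SimpleGraph.Dart.symm_symm] at h2 ⊢
  generalize z d.fst = x1 at *
  generalize z d.snd = x2 at *
  generalize Option.extendZero y (M.left d) = y1 at *
  generalize Option.extendZero y (M.left d.symm) = y2 at *
  generalize R.twist d.toEdge = t at *
  generalize M.orient R d.fst = o1 at *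
  generalize M.orient R d.snd = o2 at *
  clear h1 h3 hfz hz hg hfg hy hh hh' hsum hfe hc
  revert x1 x2 y1 y2 t o1 o2
  decide

theorem two_pow_card_face_eq_card_potentials [Finite V] (R : GeneralRotationSystem G) :
    2 ^ Nat.card R.Face = Nat.card (M.potentials (M.relTwist R)) := by
  rw [R.two_pow_card_face]
  symm
  refine Nat.card_eq_of_bijective
    (fun x => ⟨M.flagFun (M.orient R) x.1, M.flagFun_invariant R x.2⟩) ⟨fun x x' h => ?_, ?_⟩
  · exact Subtype.ext (M.flagFun_injective _ (congrArg Subtype.val h))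
  · rintro ⟨f, hf⟩
    obtain ⟨x, hx, hxf⟩ := M.flagFun_surjective R hf
    exact ⟨⟨x, hx⟩, Subtype.ext hxf⟩

end CubicPlaneMap

/-! ### The weighted dual Laplacian and its rank -/

/-- A symmetric matrix over the field with two elements has rank one if and only if it is
the product of a nonzero column with its transpose. -/
theorem Matrix.rank_eq_one_iff_of_isSymm {n : Type*} [Fintype n] [DecidableEq n]
    {L : Matrix n n (ZMod 2)} (hL : L.IsSymm) :
    L.rank = 1 ↔ ∃ x : n → ZMod 2, x ≠ 0 ∧ L = Matrix.vecMulVec x x := by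
  have h01 : ∀ c : ZMod 2, c ≠ 0 → c = 1 := by decide
  constructor
  · intro h
    have h' : Module.finrank (ZMod 2) (LinearMap.range L.mulVecLin) = 1 := h
    obtain ⟨⟨u, hu⟩, -, hspan⟩ := finrank_eq_one_iff'.1 h'
    -- All columns are multiples `c b • u` of one generator; symmetry then forces `c = u`.
    have hcol : ∀ b, ∃ c : ZMod 2, ∀ a, L a b = c * u a := by
      intro b
      obtain ⟨c, hc⟩ := hspan ⟨L.mulVecLin (Pi.single b 1), LinearMap.mem_range_self _ _⟩
      refine ⟨c, fun a => ?_⟩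
      have := congrFun (congrArg Subtype.val hc) a
      simp at this
      exact this.symm
    choose c hc using hcol
    have hne : L ≠ 0 := by rintro rfl; simp at h
    obtain ⟨a, b, hab⟩ : ∃ a b, L a b ≠ 0 := by
      by_contra! h0
      exact hne (Matrix.ext h0)
    have hcb : c b = 1 := h01 _ fun h0 => hab (by rw [hc, h0, zero_mul])
    have hua : u a = 1 := h01 _ fun h0 => hab (by rw [hc, h0, mul_zero])
    have hcu : ∀ i, c i = c a * u i := fun i => by
      have := hL.apply i a
      rw [hc, hc, hua, mul_one] at this
      exact this
    have hca : c a = 1 := h01 _ fun h0 => hab (by rw [hc, hcu, h0, zero_mul, zero_mul])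
    refine ⟨u, fun h0 => by simp [h0] at hua, ?_⟩
    ext i j
    rw [hc, hcu, hca, Matrix.vecMulVec_apply, one_mul, mul_comm]
  · rintro ⟨x, hx, rfl⟩
    refine le_antisymm (Matrix.rank_vecMulVec_le _ _) ?_
    rw [Nat.one_le_iff_ne_zero]
    intro h0
    have h1 : Module.finrank (ZMod 2) (LinearMap.range (Matrix.vecMulVec x x).mulVecLin) = 0 := h0
    rw [Submodule.finrank_eq_zero, LinearMap.range_eq_bot] at h1
    obtain ⟨a, ha⟩ := Function.ne_iff.1 hx
    have h2 := congrFun (LinearMap.congr_fun h1 (Pi.single a 1)) a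
    simp [Matrix.vecMulVec_apply] at h2
    exact ha h2

namespace CubicPlaneMap

variable {V Ψ : Type*} {G : SimpleGraph V} (M : CubicPlaneMap G Ψ)

theorem dualCob_add (y y' : Ψ → ZMod 2) : M.dualCob (y + y') = M.dualCob y + M.dualCob y' := by
  have h : ∀ o, Option.extendZero (y + y') o = Option.extendZero y o + Option.extendZero y' o := by
    rintro (_ | o) <;> simp
  funext e
  obtain ⟨d, rfl⟩ := SimpleGraph.Dart.exists_toEdge_eq e
  simp only [Pi.add_apply, dualCob_toEdge, h]
  ring

theorem dualCob_smul (c : ZMod 2) (y : Ψ → ZMod 2) : M.dualCob (c • y) = c • M.dualCob y := by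
  have h : ∀ o, Option.extendZero (c • y) o = c * Option.extendZero y o := by
    rintro (_ | o) <;> simp
  funext e
  obtain ⟨d, rfl⟩ := SimpleGraph.Dart.exists_toEdge_eq e
  simp only [Pi.smul_apply, dualCob_toEdge, h, smul_eq_mul]
  ring

/-- The dual coboundary as a linear map. -/
noncomputable def dualCobLin : (Ψ → ZMod 2) →ₗ[ZMod 2] (G.edgeSet → ZMod 2) where
  toFun := M.dualCob
  map_add' := M.dualCob_add
  map_smul' := M.dualCob_smul

variable [Fintype V] [Fintype Ψ] [DecidableEq Ψ]

open Classical in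
/-- The weighted Laplacian of the dual graph, without the row and the column of the outer face. -/
noncomputable def lap (A : G.edgeSet → ZMod 2) : Matrix Ψ Ψ (ZMod 2) := fun a b =>
  ∑ e, A e * (M.dualCob (Pi.single a 1) e * M.dualCob (Pi.single b 1) e)

omit [Fintype Ψ] in
theorem lap_isSymm (A : G.edgeSet → ZMod 2) : (M.lap A).IsSymm := by
  ext a b
  simp only [lap, Matrix.transpose_apply, mul_comm]

omit [Fintype Ψ] [DecidableEq Ψ] in
open Classical in
theorem sum_edge_mul_dualCob (p : G.edgeSet → ZMod 2) (y : Ψ → ZMod 2) :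
    ∑ e, p e * M.dualCob y e = ∑ d : G.Dart, Option.extendZero y (M.left d) * p d.toEdge := by
  symm
  apply SimpleGraph.sum_dart_eq_sum_edge
  intro d
  rw [dualCob_toEdge, SimpleGraph.Dart.toEdge_symm]
  ring

omit [Fintype V] in
theorem sum_mul_dualCob_single (y : Ψ → ZMod 2) (e : G.edgeSet) :
    ∑ b, M.dualCob (Pi.single b 1) e * y b = M.dualCob y e := by
  have h := M.dualCobLin.pi_apply_eq_sum_univ y
  have h1 := congrFun h e
  simp only [Finset.sum_apply, Pi.smul_apply, smul_eq_mul] at h1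
  change M.dualCob y e = _ at h1
  rw [h1]
  refine Finset.sum_congr rfl fun b _ => ?_
  rw [mul_comm]
  congr 1
  change _ = M.dualCob _ e
  congr 1
  funext j
  simp [Pi.single_apply, eq_comm]

open Classical in
theorem lap_mulVec (A : G.edgeSet → ZMod 2) (y : Ψ → ZMod 2) (a : Ψ) :
    (M.lap A).mulVec y a = ∑ e, (A e * M.dualCob y e) * M.dualCob (Pi.single a 1) e := by
  simp only [Matrix.mulVec, dotProduct, lap, Finset.sum_mul]
  rw [Finset.sum_comm]
  refine Finset.sum_congr rfl fun e _ => ?_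
  rw [← M.sum_mul_dualCob_single y, Finset.mul_sum, Finset.sum_mul]
  exact Finset.sum_congr rfl fun b _ => by ring

-- `lap A` kills `y` when `A` times the dual coboundary of `y` sums to zero around every inner face,
-- and by `exists_edgeCoboundary_eq` that makes it a coboundary.
open Classical in
theorem lap_mulVec_eq_zero_iff (A : G.edgeSet → ZMod 2) (y : Ψ → ZMod 2) :
    (M.lap A).mulVec y = 0 ↔ ∃ z, (y, z) ∈ M.potentials A := by
  constructor
  · intro h
    obtain ⟨z, hz⟩ := M.exists_edgeCoboundary_eq (fun e => A e * M.dualCob y e) (by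
      intro y'
      have h1 := M.sum_edge_mul_dualCob (fun e => A e * M.dualCob y e) y'
      have h2 : ∑ e, (A e * M.dualCob y e) * M.dualCob y' e = 0 := by
        simp_rw [← M.sum_mul_dualCob_single y', Finset.mul_sum]
        rw [Finset.sum_comm]
        refine Finset.sum_eq_zero fun a _ => ?_
        simp_rw [← mul_assoc]
        rw [← Finset.sum_mul, ← lap_mulVec, h, Pi.zero_apply, zero_mul]
      rw [h2] at h1
      exact h1.symm)
    exact ⟨z, congrFun hz⟩
  · rintro ⟨z, hz⟩
    funext a
    rw [lap_mulVec, M.sum_edge_mul_dualCob, Pi.zero_apply]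
    have hz' : ∀ e, A e * M.dualCob y e = edgeCoboundary G z e := fun e => (hz e).symm
    simp_rw [hz']
    exact M.sum_face_edgeCoboundary _ _

/-- Over each `y` in the kernel, `z` is unique up to a constant because the graph is connected; this
gives the extra factor 2. -/
theorem card_potentials (hG : G.Connected) (A : G.edgeSet → ZMod 2) :
    Nat.card (M.potentials A) = 2 ^ (Fintype.card Ψ - (M.lap A).rank + 1) := by
  classical
  obtain ⟨r⟩ := hG.nonempty
  let Φ : M.potentials A → LinearMap.ker (M.lap A).mulVecLin × ZMod 2 := fun x =>
    (⟨x.1.1, (M.lap_mulVec_eq_zero_iff A x.1.1).2 ⟨x.1.2, x.2⟩⟩, x.1.2 r)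
  have hΦ : Function.Bijective Φ := by
    constructor
    · rintro ⟨⟨y, z⟩, hx⟩ ⟨⟨y', z'⟩, hx'⟩ h
      obtain rfl : y = y' := congrArg (fun w => w.1.1) h
      have hr : z r = z' r := congrArg Prod.snd h
      have hzz : ∀ a b, G.Adj a b → z a + z' a = z b + z' b := by
        intro a b hab
        have h1 := (hx (SimpleGraph.Dart.toEdge ⟨(a, b), hab⟩)).trans (hx' _).symm
        simp only [edgeCoboundary_toEdge] at h1
        generalize z a = x1 at *
        generalize z b = x2 at *
        generalize z' a = x3 at *
        generalize z' b = x4 at *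
        clear hx hx' h
        revert x1 x2 x3 x4; decide
      have : z = z' := by
        funext v
        have h4 := hG.eq_of_adj_eq hzz v r
        rw [hr, CharTwo.add_self_eq_zero] at h4
        exact CharTwo.add_eq_zero.1 h4
      rw [Subtype.mk.injEq, this]
    · rintro ⟨⟨y, hy⟩, c⟩
      obtain ⟨z, hz⟩ := (M.lap_mulVec_eq_zero_iff A y).1 hy
      refine ⟨⟨(y, fun v => z v + (z r + c)), fun e => ?_⟩, ?_⟩
      · rw [← hz e]
        obtain ⟨d, rfl⟩ := SimpleGraph.Dart.exists_toEdge_eq e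
        simp only [edgeCoboundary_toEdge]
        generalize z r + c = k
        generalize z d.fst = x1
        generalize z d.snd = x2
        revert k x1 x2; decide
      · simp only [Φ, Prod.mk.injEq, true_and]
        exact CharTwo.add_cancel_left _ _
  have hk : Module.finrank (ZMod 2) (LinearMap.ker (M.lap A).mulVecLin) =
      Fintype.card Ψ - (M.lap A).rank := by
    have := LinearMap.finrank_range_add_finrank_ker (M.lap A).mulVecLin
    rw [Module.finrank_fintype_fun_eq_card] at this
    change (M.lap A).rank + _ = _ at this
    omega
  rw [Nat.card_eq_of_bijective Φ hΦ, Nat.card_prod, Nat.card_zmod, pow_succ, ← hk,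
    Nat.card_eq_fintype_card, Module.card_eq_pow_finrank (K := ZMod 2), ZMod.card]

theorem card_face (hG : G.Connected) (R : GeneralRotationSystem G) :
    Nat.card R.Face + (M.lap (M.relTwist R)).rank = Fintype.card Ψ + 1 := by
  have h := M.two_pow_card_face_eq_card_potentials R
  rw [M.card_potentials hG] at h
  have h1 := Nat.pow_right_injective le_rfl h
  have h2 := (M.lap (M.relTwist R)).rank_le_card_width
  omega

end CubicPlaneMap

/-! ### Laplacians of rank zero and one, and cliques of the inner dual -/

namespace CubicPlaneMap

variable {V Ψ : Type*} {G : SimpleGraph V} (M : CubicPlaneMap G Ψ)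

/-- Adjacency of inner faces. -/
def innerDual : SimpleGraph Ψ where
  Adj a b := ∃ d, M.left d = some a ∧ M.left d.symm = some b
  symm := ⟨fun _ _ ⟨d, h, h'⟩ => ⟨d.symm, h', by rwa [SimpleGraph.Dart.symm_symm]⟩⟩
  loopless := ⟨fun _ ⟨d, h, h'⟩ => M.left_ne d (h.trans h'.symm)⟩

theorem extendZero_single [DecidableEq Ψ] (a : Ψ) (o : Option Ψ) :
    Option.extendZero (Pi.single a 1) o = if o = some a then 1 else 0 := by
  rcases o with _ | b <;> simp [Pi.single_apply]

theorem dualCob_single [DecidableEq Ψ] (a : Ψ) (d : G.Dart) :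
    M.dualCob (Pi.single a 1) d.toEdge =
      (if M.left d = some a then 1 else 0) + if M.left d.symm = some a then 1 else 0 := by
  rw [dualCob_toEdge, extendZero_single, extendZero_single]

theorem dualCob_single_mul_ne_zero [DecidableEq Ψ] {a b : Ψ} (hab : a ≠ b) {d : G.Dart}
    (h : M.dualCob (Pi.single a 1) d.toEdge * M.dualCob (Pi.single b 1) d.toEdge ≠ 0) :
    (M.left d = some a ∧ M.left d.symm = some b) ∨
      (M.left d = some b ∧ M.left d.symm = some a) := by
  rw [dualCob_single, dualCob_single] at h
  by_cases h1 : M.left d = some a <;> by_cases h2 : M.left d = some b <;>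
    by_cases h3 : M.left d.symm = some a <;> by_cases h4 : M.left d.symm = some b <;>
    simp_all

variable [Fintype V] [Fintype Ψ] [DecidableEq Ψ]

-- By `left_inj`, adjacent inner faces share just one edge, so the sum has one term.
omit [Fintype Ψ] in
theorem lap_apply_of_left {a b : Ψ} {d : G.Dart} (ha : M.left d = some a)
    (hb : M.left d.symm = some b) (A : G.edgeSet → ZMod 2) : M.lap A a b = A d.toEdge := by
  classical
  have hab : a ≠ b := fun h => M.left_ne d (by rw [ha, hb, h])
  unfold lap
  rw [Finset.sum_eq_single d.toEdge]
  · simp [dualCob_single, ha, hb, hab, hab.symm]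
  · intro e _ he
    obtain ⟨c, rfl⟩ := SimpleGraph.Dart.exists_toEdge_eq e
    by_contra h
    rcases M.dualCob_single_mul_ne_zero hab (right_ne_zero_of_mul h) with ⟨h1, h2⟩ | ⟨h1, h2⟩
    · exact he (congrArg _ (M.left_inj c d (h1.trans ha.symm) (h2.trans hb.symm)))
    · rw [← SimpleGraph.Dart.toEdge_symm] at he
      exact he (congrArg _ (M.left_inj _ d (h2.trans ha.symm)
        (by rw [SimpleGraph.Dart.symm_symm, h1, hb])))
  · simp

omit [Fintype Ψ] in
theorem lap_apply_of_not_adj {a b : Ψ} (hab : a ≠ b) (h : ¬ M.innerDual.Adj a b)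
    (A : G.edgeSet → ZMod 2) : M.lap A a b = 0 := by
  classical
  refine Finset.sum_eq_zero fun e _ => ?_
  obtain ⟨c, rfl⟩ := SimpleGraph.Dart.exists_toEdge_eq e
  by_contra h0
  rcases M.dualCob_single_mul_ne_zero hab (right_ne_zero_of_mul h0) with h1 | h1
  · exact h ⟨c, h1⟩
  · exact h (SimpleGraph.Adj.symm (G := M.innerDual) ⟨c, h1⟩)

omit [Fintype Ψ] in
open Classical in
theorem lap_diag (A : G.edgeSet → ZMod 2) (a : Ψ) :
    M.lap A a a = ∑ d : G.Dart with M.left d = some a, A d.toEdge := by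
  have h : ∀ c : ZMod 2, c * c = c := by decide
  simp only [lap, h, M.sum_edge_mul_dualCob, extendZero_single, ite_mul, one_mul, zero_mul,
    Finset.sum_filter]

omit [Fintype Ψ] in
theorem lap_add (A A' : G.edgeSet → ZMod 2) : M.lap (A + A') = M.lap A + M.lap A' := by
  ext a b
  simp only [lap, Pi.add_apply, Matrix.add_apply, add_mul, Finset.sum_add_distrib]

-- The off-diagonal entries give `A` on the edges between inner faces; the diagonal entry of a face
-- then gives `A` on its single outer edge.
omit [Fintype Ψ] in
theorem lap_eq_zero_iff {A : G.edgeSet → ZMod 2} : M.lap A = 0 ↔ A = 0 := by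
  classical
  constructor
  · intro h
    have h0 : ∀ d : G.Dart, M.left d ≠ none → M.left d.symm ≠ none → A d.toEdge = 0 := by
      intro d h1 h2
      obtain ⟨a, ha⟩ := Option.ne_none_iff_exists'.1 h1
      obtain ⟨b, hb⟩ := Option.ne_none_iff_exists'.1 h2
      rw [← M.lap_apply_of_left ha hb A, h, Matrix.zero_apply]
    have h1 : ∀ d : G.Dart, M.left d.symm = none → A d.toEdge = 0 := by
      intro d hd
      obtain ⟨a, ha⟩ := Option.ne_none_iff_exists'.1 fun h0 => M.left_ne d (h0.trans hd.symm)
      have h2 := M.lap_diag A a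
      rw [h, Matrix.zero_apply, Finset.sum_eq_single_of_mem d (by simpa using ha)] at h2
      · exact h2.symm
      · intro c hc hcd
        have hc' : M.left c = some a := by simpa using hc
        exact h0 c (by simp [hc']) fun h3 =>
          hcd (M.left_inj _ _ (hc'.trans ha.symm) (h3.trans hd.symm))
    funext e
    obtain ⟨d, rfl⟩ := SimpleGraph.Dart.exists_toEdge_eq e
    by_cases h2 : M.left d.symm = none
    · exact h1 d h2
    by_cases h3 : M.left d = none
    · rw [← SimpleGraph.Dart.toEdge_symm]
      exact h1 _ (by rwa [SimpleGraph.Dart.symm_symm])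
    exact h0 d h3 h2
  · rintro rfl
    ext a b
    simp [lap]

omit [Fintype Ψ] in
theorem lap_injective : Function.Injective M.lap := by
  intro A A' h
  have h1 : A + A' = 0 := by
    rw [← M.lap_eq_zero_iff, lap_add, h]
    ext a b
    exact CharTwo.add_self_eq_zero _
  funext e
  exact CharTwo.add_eq_zero.1 (congrFun h1 e)

theorem rank_lap_eq_zero_iff {A : G.edgeSet → ZMod 2} : (M.lap A).rank = 0 ↔ A = 0 := by
  rw [← M.lap_eq_zero_iff]
  constructor
  · intro h
    have h1 : Module.finrank (ZMod 2) (LinearMap.range (M.lap A).mulVecLin) = 0 := h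
    rw [Submodule.finrank_eq_zero, LinearMap.range_eq_bot] at h1
    ext a b
    simpa using congrFun (LinearMap.congr_fun h1 (Pi.single b 1)) a
  · intro h
    rw [h, Matrix.rank_zero]

/-- The extension of a function on the inner faces to all faces with sum zero. -/
def extendSum (x : Ψ → ZMod 2) (o : Option Ψ) : ZMod 2 := o.elim (∑ a, x a) x

/-- The relative twists whose Laplacian is the product of `x` with its transpose. -/
noncomputable def prodTwist (x : Ψ → ZMod 2) (e : G.edgeSet) : ZMod 2 :=
  extendSum x (M.left (SimpleGraph.Dart.exists_toEdge_eq e).choose) *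
    extendSum x (M.left (SimpleGraph.Dart.exists_toEdge_eq e).choose.symm)

omit [Fintype V] [DecidableEq Ψ] in
theorem prodTwist_toEdge (x : Ψ → ZMod 2) (d : G.Dart) :
    M.prodTwist x d.toEdge = extendSum x (M.left d) * extendSum x (M.left d.symm) := by
  unfold prodTwist
  have h := (SimpleGraph.Dart.exists_toEdge_eq d.toEdge).choose_spec
  generalize (SimpleGraph.Dart.exists_toEdge_eq d.toEdge).choose = c at *
  rcases (SimpleGraph.dart_edge_eq_iff c d).1 (congrArg Subtype.val h) with rfl | rfl
  · rfl
  · rw [SimpleGraph.Dart.symm_symm, mul_comm]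

/-- Off the diagonal this is the definition of `prodTwist`. On the diagonal, a face `a` in the
support of `x` borders the outer face and all other faces of the support. The extended values have
total zero, so those of all faces except `a` add up to `x a`. -/
theorem lap_prodTwist {x : Ψ → ZMod 2}
    (hx : ∀ a b, a ≠ b → x a ≠ 0 → x b ≠ 0 → M.innerDual.Adj a b) :
    M.lap (M.prodTwist x) = Matrix.vecMulVec x x := by
  classical
  ext a b
  rw [Matrix.vecMulVec_apply]
  by_cases hab : a = b
  · subst hab
    rw [lap_diag]
    have h1 : ∀ d ∈ Finset.univ.filter (fun d : G.Dart => M.left d = some a),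
        M.prodTwist x d.toEdge = x a * extendSum x (M.left d.symm) := by
      intro d hd
      rw [prodTwist_toEdge, (Finset.mem_filter.1 hd).2]
      rfl
    rw [Finset.sum_congr rfl h1, ← Finset.mul_sum]
    by_cases hxa : x a = 0
    · rw [hxa, zero_mul, zero_mul]
    congr 1
    rw [← Finset.sum_image (g := fun d : G.Dart => M.left d.symm) (f := extendSum x)]
    · rw [Finset.sum_subset (s₂ := Finset.univ.erase (some a))]
      · have h2 := Finset.sum_erase_add Finset.univ (extendSum x) (Finset.mem_univ (some a))
        rw [Fintype.sum_option] at h2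
        change _ + x a = (∑ c, x c) + ∑ c, x c at h2
        rw [CharTwo.add_self_eq_zero] at h2
        exact CharTwo.add_eq_zero.1 h2
      · intro o ho
        obtain ⟨d, hd, rfl⟩ := Finset.mem_image.1 ho
        refine Finset.mem_erase.2 ⟨fun h => ?_, Finset.mem_univ _⟩
        exact M.left_ne d ((Finset.mem_filter.1 hd).2.trans h.symm)
      · intro o ho ho'
        by_contra h
        apply ho'
        rw [Finset.mem_image]
        rcases o with _ | b
        · obtain ⟨d, hd, hd'⟩ := M.outer a
          exact ⟨d, by simpa using hd, hd'⟩
        · obtain ⟨d, hd, hd'⟩ := hx a b (fun h0 => by simp [h0] at ho) hxa h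
          exact ⟨d, by simpa using hd, hd'⟩
    · intro d hd c hc hdc
      have hd' : M.left d = some a := by simpa using hd
      have hc' : M.left c = some a := by simpa using hc
      exact M.left_inj d c (hd'.trans hc'.symm) hdc
  · by_cases hadj : M.innerDual.Adj a b
    · obtain ⟨d, hd, hd'⟩ := hadj
      rw [M.lap_apply_of_left hd hd', prodTwist_toEdge, hd, hd']
      rfl
    · rw [M.lap_apply_of_not_adj hab hadj]
      by_contra h
      exact hadj (hx a b hab (left_ne_zero_of_mul (Ne.symm h)) (right_ne_zero_of_mul (Ne.symm h)))

/-- The bijection sends a clique to `prodTwist` of its indicator. It is onto because a rank one `lap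
A` is `x xᵀ`, the support of `x` is a clique as entries at nonadjacent faces vanish, and `lap` is
injective. -/
theorem card_rank_lap_eq_one :
    Nat.card {A : G.edgeSet → ZMod 2 // (M.lap A).rank = 1} =
      Nat.card {S : Finset Ψ // S.Nonempty ∧ M.innerDual.IsClique S} := by
  classical
  let ind : Finset Ψ → Ψ → ZMod 2 := fun S a => if a ∈ S then 1 else 0
  have hind : ∀ S a, ind S a ≠ 0 ↔ a ∈ S := by intro S a; simp [ind]
  have hlap : ∀ S : Finset Ψ, M.innerDual.IsClique S →
      M.lap (M.prodTwist (ind S)) = Matrix.vecMulVec (ind S) (ind S) := fun S hS =>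
    M.lap_prodTwist fun a b hab ha hb => hS ((hind _ _).1 ha) ((hind _ _).1 hb) hab
  symm
  refine Nat.card_eq_of_bijective (fun S => ⟨M.prodTwist (ind S.1), ?_⟩) ⟨?_, ?_⟩
  · rw [Matrix.rank_eq_one_iff_of_isSymm (M.lap_isSymm _)]
    obtain ⟨a, ha⟩ := S.2.1
    exact ⟨ind S.1, fun h => (hind _ _).2 ha (congrFun h a), hlap _ S.2.2⟩
  · rintro ⟨S, hS, hSc⟩ ⟨S', hS', hSc'⟩ h
    have h1 : Matrix.vecMulVec (ind S) (ind S) = Matrix.vecMulVec (ind S') (ind S') := by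
      rw [← hlap S hSc, ← hlap S' hSc']
      exact congrArg (fun A => M.lap A.1) h
    apply Subtype.ext
    ext a
    have h2 := congrFun (congrFun h1 a) a
    simp only [Matrix.vecMulVec_apply] at h2
    rw [← hind S, ← hind S', ← mul_self_ne_zero, h2, mul_self_ne_zero]
  · rintro ⟨A, hA⟩
    obtain ⟨x, hx, hL⟩ := (Matrix.rank_eq_one_iff_of_isSymm (M.lap_isSymm _)).1 hA
    have hS : ind (Finset.univ.filter fun a => x a ≠ 0) = x := by
      funext a
      have h01 : ∀ c : ZMod 2, c ≠ 0 → 1 = c := by decide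
      by_cases h : x a = 0
      · simp [ind, h]
      · simp [ind, h, h01 _ h]
    have hc : M.innerDual.IsClique (Finset.univ.filter fun a => x a ≠ 0 : Finset Ψ) := by
      intro a ha b hb hab
      by_contra h
      have h1 := M.lap_apply_of_not_adj hab h A
      rw [hL, Matrix.vecMulVec_apply] at h1
      simp only [Finset.coe_filter, Finset.mem_univ, true_and, Set.mem_ofPred_eq] at ha hb
      exact mul_ne_zero ha hb h1
    obtain ⟨a, ha⟩ := Function.ne_iff.1 hx
    refine ⟨⟨_, ⟨a, by simpa using ha⟩, hc⟩, Subtype.ext (M.lap_injective ?_)⟩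
    change M.lap (M.prodTwist (ind _)) = M.lap A
    rw [hlap _ hc, hS, hL]

/-! ### From the rank to the surface -/

omit [Fintype V] [Fintype Ψ] [DecidableEq Ψ] in
theorem exists_relTwist_eq_of_isOrientable {R : GeneralRotationSystem G} (h : R.IsOrientable) :
    ∃ t, M.relTwist R = edgeCoboundary G t := by
  obtain ⟨s, hs⟩ := h
  refine ⟨s + M.orient R, funext fun e => ?_⟩
  obtain ⟨d, rfl⟩ := SimpleGraph.Dart.exists_toEdge_eq e
  have h1 : R.twist d.toEdge = s d.fst + s d.snd := hs d
  simp only [CubicRotation.relTwist, h1, edgeCoboundary_toEdge, Pi.add_apply]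
  ring

omit [Fintype V] [Fintype Ψ] [DecidableEq Ψ] in
theorem isOrientable_of_relTwist_eq_zero {R : GeneralRotationSystem G}
    (h : M.relTwist R = 0) : R.IsOrientable :=
  ⟨M.orient R, fun d => CharTwo.add_eq_zero.1 (congrFun h d.toEdge)⟩

/-- For an orientable system the relative twist is a coboundary, so its sums around faces, the
diagonal entries of `lap`, are zero. But `x xᵀ` with `x ≠ 0` has a nonzero diagonal entry. -/
theorem not_isOrientable_of_rank_eq_one {R : GeneralRotationSystem G}
    (h : (M.lap (M.relTwist R)).rank = 1) : ¬ R.IsOrientable := by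
  classical
  intro ho
  obtain ⟨t, ht⟩ := M.exists_relTwist_eq_of_isOrientable ho
  obtain ⟨x, hx, hL⟩ := (Matrix.rank_eq_one_iff_of_isSymm (M.lap_isSymm _)).1 h
  obtain ⟨a, ha⟩ := Function.ne_iff.1 hx
  have h1 := M.lap_diag (M.relTwist R) a
  have h2 := M.sum_face_edgeCoboundary (fun o => if o = some a then 1 else 0) t
  simp only [ite_mul, one_mul, zero_mul, ← Finset.sum_filter] at h2
  rw [ht, h2, ← ht, hL, Matrix.vecMulVec_apply] at h1
  exact ha (mul_self_eq_zero.1 h1)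

/-- The hypothesis `hE` is Euler's formula for the plane map, which has `|Ψ| + 1` faces. -/
theorem eulerChar_eq (hG : G.Connected)
    (hE : Nat.card V + Fintype.card Ψ = Nat.card G.edgeSet + 1) (R : GeneralRotationSystem G) :
    R.eulerChar = 2 - ((M.lap (M.relTwist R)).rank : ℤ) := by
  have h := M.card_face hG R
  unfold GeneralRotationSystem.eulerChar
  omega

theorem exists_embedsIn_genus_zero_iff (hG : G.Connected)
    (hE : Nat.card V + Fintype.card Ψ = Nat.card G.edgeSet + 1) (R : GeneralRotationSystem G) :
    (∃ S : ClosedSurface, S.eulerGenus = 0 ∧ R.EmbedsIn S) ↔ M.relTwist R = 0 := by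
  constructor
  · rintro ⟨S, hS, -, h⟩
    rw [M.eulerChar_eq hG hE] at h
    rw [← M.rank_lap_eq_zero_iff]
    cases S with
    | orientable j => simp only [ClosedSurface.eulerGenus, ClosedSurface.eulerChar] at hS h; omega
    | nonorientable k => exact absurd hS k.pos.ne'
  · intro h
    refine ⟨.orientable 0, rfl, ?_, ?_⟩
    · exact iff_of_true (M.isOrientable_of_relTwist_eq_zero h) trivial
    · rw [M.eulerChar_eq hG hE, M.rank_lap_eq_zero_iff.2 h]
      rfl

theorem exists_embedsIn_genus_one_iff (hG : G.Connected)
    (hE : Nat.card V + Fintype.card Ψ = Nat.card G.edgeSet + 1) (R : GeneralRotationSystem G) :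
    (∃ S : ClosedSurface, S.eulerGenus = 1 ∧ R.EmbedsIn S) ↔
      (M.lap (M.relTwist R)).rank = 1 := by
  constructor
  · rintro ⟨S, hS, -, h⟩
    rw [M.eulerChar_eq hG hE] at h
    cases S with
    | orientable j => simp only [ClosedSurface.eulerGenus] at hS; omega
    | nonorientable k =>
      simp only [ClosedSurface.eulerGenus, ClosedSurface.eulerChar] at hS h
      omega
  · intro h
    refine ⟨.nonorientable 1, rfl, ?_, ?_⟩
    · exact iff_of_false (M.not_isOrientable_of_rank_eq_one h) id
    · rw [M.eulerChar_eq hG hE, h]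
      rfl

variable {T : SimpleGraph V} (hle : T ≤ G) (hT : T.IsTree)

include M hle hT

theorem embeddingCount_zero (hE : Nat.card V + Fintype.card Ψ = Nat.card G.edgeSet + 1) :
    embeddingCount G T 0 = 2 := by
  have hG : G.Connected := hT.connected.mono hle
  unfold embeddingCount
  simp only [M.exists_embedsIn_genus_zero_iff hG hE]
  rw [M.card_isTRotationSystem hle hT (P := fun A => A = 0)]
  simp

theorem embeddingCount_one (hE : Nat.card V + Fintype.card Ψ = Nat.card G.edgeSet + 1) :
    embeddingCount G T 1 =
      2 * Nat.card {S : Finset Ψ // S.Nonempty ∧ M.innerDual.IsClique S} := by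
  have hG : G.Connected := hT.connected.mono hle
  unfold embeddingCount
  simp only [M.exists_embedsIn_genus_one_iff hG hE]
  rw [M.card_isTRotationSystem hle hT (P := fun A => (M.lap A).rank = 1), M.card_rank_lap_eq_one]

end CubicPlaneMap

/-! ### Counting cliques along an elimination order -/

/-- In a graph on a linear order in which the smaller neighbours of every vertex form a clique,
a nonempty clique consists of its maximum and a set of smaller neighbours of the maximum. -/
theorem SimpleGraph.card_nonempty_cliques {α : Type*} [Fintype α] [LinearOrder α]
    (D : SimpleGraph α) (low : α → Finset α) (hlow : ∀ a b, a ∈ low b ↔ a < b ∧ D.Adj a b)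
    (hclique : ∀ b, D.IsClique (low b)) :
    Nat.card {S : Finset α // S.Nonempty ∧ D.IsClique S} = ∑ b, 2 ^ (low b).card := by
  have hins : ∀ b, ∀ T ⊆ low b, D.IsClique (insert b T : Finset α) := by
    intro b T hT
    rw [Finset.coe_insert]
    exact ((hclique b).subset hT).insert fun a ha _ => ((hlow a b).1 (hT ha)).2.symm
  let Φ : (Σ b, (low b).powerset) → {S : Finset α // S.Nonempty ∧ D.IsClique S} := fun x =>
    ⟨insert x.1 x.2.1, Finset.insert_nonempty _ _, hins _ _ (Finset.mem_powerset.1 x.2.2)⟩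
  have hΦ : Function.Bijective Φ := by
    constructor
    · rintro ⟨b, T, hT⟩ ⟨b', T', hT'⟩ h
      have hT1 : ∀ a ∈ T, a < b := fun a ha => ((hlow a b).1 (Finset.mem_powerset.1 hT ha)).1
      have hT1' : ∀ a ∈ T', a < b' :=
        fun a ha => ((hlow a b').1 (Finset.mem_powerset.1 hT' ha)).1
      have h1 : insert b T = insert b' T' := congrArg Subtype.val h
      have hb : b = b' := by
        have h2 : b ∈ insert b' T' := h1 ▸ Finset.mem_insert_self b T
        have h3 : b' ∈ insert b T := h1.symm ▸ Finset.mem_insert_self b' T'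
        rcases Finset.mem_insert.1 h2 with h2 | h2
        · exact h2
        rcases Finset.mem_insert.1 h3 with h3 | h3
        · exact h3.symm
        exact absurd (hT1 _ h3) (hT1' _ h2).asymm
      subst hb
      have h2 := congrArg (fun S => S.erase b) h1
      beta_reduce at h2
      rw [Finset.erase_insert fun h => (hT1 b h).false,
        Finset.erase_insert fun h => (hT1' b h).false] at h2
      subst h2
      rfl
    · rintro ⟨S, hS, hc⟩
      refine ⟨⟨S.max' hS, S.erase (S.max' hS), Finset.mem_powerset.2 fun a ha => ?_⟩,
        Subtype.ext (Finset.insert_erase (S.max'_mem hS))⟩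
      have ha' := Finset.mem_erase.1 ha
      exact (hlow _ _).2 ⟨(S.le_max' a ha'.2).lt_of_ne ha'.1,
        hc ha'.2 (S.max'_mem hS) ha'.1⟩
  rw [← Nat.card_eq_of_bijective Φ hΦ, Nat.card_sigma]
  refine Finset.sum_congr rfl fun b _ => ?_
  rw [Nat.card_eq_fintype_card, Fintype.card_coe, Finset.card_powerset]

/-! ### Plane maps from face labellings -/

/-- A labelling of the faces of a plane cubic graph, without the choice of the rotation: around
each vertex, the darts can be ordered so that the face on the left of a dart is
the face on the right of the next one. -/
structure FaceLabelling {V : Type*} (G : SimpleGraph V) (Ψ : Type*) where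
  /-- the face on the left of a dart -/
  left : G.Dart → Option Ψ
  star : ∀ v, ∃ n : Fin 3 → G.Dart, (∀ i, (n i).fst = v) ∧
    (∀ d : G.Dart, d.fst = v → ∃ i, n i = d) ∧
    (∀ i, left (n (i + 1)).symm = left (n i)) ∧ Function.Injective (left ∘ n)
  left_inj : ∀ d d', left d = left d' → left d.symm = left d'.symm → d = d'
  outer : ∀ ψ, ∃ d, left d = some ψ ∧ left d.symm = none
  forest : ∀ p : G.edgeSet → ZMod 2, ∃ z : V → ZMod 2, ∀ d, left d ≠ none →
    left d.symm ≠ none → p d.toEdge = edgeCoboundary G z d.toEdge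

namespace FaceLabelling

variable {V Ψ : Type*} {G : SimpleGraph V} (N : FaceLabelling G Ψ)

/-- The chosen numbering of the darts at a vertex. -/
noncomputable def dartAt (x : V × Fin 3) : G.Dart := (N.star x.1).choose x.2

theorem fst_dartAt (x : V × Fin 3) : (N.dartAt x).fst = x.1 := (N.star x.1).choose_spec.1 x.2

theorem left_dartAt_add_one (v : V) (i : Fin 3) :
    N.left (N.dartAt (v, i + 1)).symm = N.left (N.dartAt (v, i)) :=
  (N.star v).choose_spec.2.2.1 i

theorem bijective_dartAt : Function.Bijective N.dartAt := by
  constructor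
  · rintro ⟨v, i⟩ ⟨v', i'⟩ h
    have h1 := congrArg (fun d => d.fst) h
    simp only [fst_dartAt] at h1
    subst h1
    exact congrArg (Prod.mk v) ((N.star v).choose_spec.2.2.2 (congrArg N.left h))
  · intro d
    obtain ⟨i, hi⟩ := (N.star d.fst).choose_spec.2.1 d rfl
    exact ⟨(d.fst, i), hi⟩

/-- The darts are numbered by the vertices and three directions. -/
noncomputable def dartEquiv : V × Fin 3 ≃ G.Dart := Equiv.ofBijective _ N.bijective_dartAt

/-- The rotation that belongs to the numbering of the darts. -/
noncomputable def rot : Equiv.Perm G.Dart :=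
  N.dartEquiv.symm.trans (((Equiv.refl V).prodCongr (Equiv.addRight 1)).trans N.dartEquiv)

theorem rot_dartAt (v : V) (i : Fin 3) : N.rot (N.dartAt (v, i)) = N.dartAt (v, i + 1) := by
  change N.dartEquiv _ = _
  have : N.dartEquiv.symm (N.dartAt (v, i)) = (v, i) := N.dartEquiv.symm_apply_apply (v, i)
  simp only [this]
  rfl

theorem rot_symm_dartAt (v : V) (i : Fin 3) :
    N.rot.symm (N.dartAt (v, i)) = N.dartAt (v, i - 1) := by
  rw [Equiv.symm_apply_eq, rot_dartAt, sub_add_cancel]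

theorem dartAt_ne {v : V} {i j : Fin 3} (h : i ≠ j) : N.dartAt (v, i) ≠ N.dartAt (v, j) :=
  fun h1 => h (congrArg Prod.snd (N.bijective_dartAt.1 h1))

/-- The plane embedding given by a labelling of the faces. -/
noncomputable def toCubicPlaneMap : CubicPlaneMap G Ψ where
  rot := N.rot
  fst_rot d := by
    obtain ⟨⟨v, i⟩, rfl⟩ := N.bijective_dartAt.2 d
    rw [rot_dartAt, fst_dartAt, fst_dartAt]
  star d d' h := by
    obtain ⟨⟨v, i⟩, rfl⟩ := N.bijective_dartAt.2 d
    obtain ⟨⟨v', j⟩, rfl⟩ := N.bijective_dartAt.2 d'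
    rw [fst_dartAt, fst_dartAt] at h
    change v' = v at h
    subst h
    rw [rot_dartAt, rot_symm_dartAt]
    have h3 : ∀ i j : Fin 3, j = i ∨ j = i + 1 ∨ j = i - 1 := by decide
    rcases h3 i j with rfl | rfl | rfl <;> simp
  rot_ne d := by
    obtain ⟨⟨v, i⟩, rfl⟩ := N.bijective_dartAt.2 d
    rw [rot_dartAt]
    exact N.dartAt_ne (by revert i; decide)
  rot_ne_symm d := by
    obtain ⟨⟨v, i⟩, rfl⟩ := N.bijective_dartAt.2 d
    rw [rot_dartAt, rot_symm_dartAt]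
    exact N.dartAt_ne (by revert i; decide)
  exists_dart v := ⟨_, N.fst_dartAt (v, 0)⟩
  left := N.left
  left_rot d := by
    obtain ⟨⟨v, i⟩, rfl⟩ := N.bijective_dartAt.2 d
    rw [rot_dartAt, left_dartAt_add_one]
  left_ne d := by
    obtain ⟨⟨v, i⟩, rfl⟩ := N.bijective_dartAt.2 d
    have h := N.left_dartAt_add_one v (i - 1)
    rw [sub_add_cancel] at h
    rw [h]
    intro h1
    have h2 : i = i - 1 := (N.star v).choose_spec.2.2.2 h1
    revert h2
    clear h1 h
    revert i
    decide
  left_inj := N.left_inj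
  outer := N.outer
  forest := N.forest

-- Each vertex has three darts and each edge two.
include N in
theorem two_mul_card_edgeSet [Finite V] : 2 * Nat.card G.edgeSet = 3 * Nat.card V := by
  classical
  cases nonempty_fintype V
  have h := SimpleGraph.dart_card_eq_twice_card_edges (G := G)
  rw [← SimpleGraph.card_edgeSet, ← Fintype.card_congr N.dartEquiv, Fintype.card_prod,
    Fintype.card_fin] at h
  rw [Nat.card_eq_fintype_card, Nat.card_eq_fintype_card]
  omega

end FaceLabelling

/-! ### The faces and adjacencies of the caterpillar-Halin graph -/

namespace CaterpillarHalin

variable (w : List Bool)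

/-- The number of the inner face on the side `c` of the spine behind the first `n` spine vertices:
the first upper and lower inner faces have the numbers `0` and `1`, and the face that begins at
the pending edge of the `i`-th spine vertex (counted from zero) has the number `i + 2`. -/
def currentFace (c : Bool) : ℕ → ℕ
  | 0 => if c then 0 else 1
  | i + 1 => if w[i]? = some c then i + 2 else currentFace c i

/-- The leaf with the number `a` lies on the side `c`. -/
def Side (c : Bool) (a : ℕ) : Prop :=
  a = 0 ∨ a = w.length + 1 ∨ ∃ i, a = i + 1 ∧ w[i]? = some c

/-- The leaves with the numbers `a < b` are consecutive on the side `c`. -/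
def Link (c : Bool) (a b : ℕ) : Prop :=
  a < b ∧ b ≤ w.length + 1 ∧ Side w c a ∧ Side w c b ∧ ∀ x, a < x → x < b → ¬ Side w c x

variable {w}

theorem getElem?_lt {i : ℕ} {c : Bool} (h : w[i]? = some c) : i < w.length :=
  (List.getElem?_eq_some_iff.1 h).1

theorem currentFace_le (c : Bool) (n : ℕ) : currentFace w c n ≤ n + 1 := by
  induction n with
  | zero => cases c <;> simp [currentFace]
  | succ n ih => unfold currentFace; split_ifs <;> omega

theorem currentFace_eq_or (c : Bool) (n : ℕ) :
    currentFace w c n = (if c then 0 else 1) ∨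
      ∃ j < n, w[j]? = some c ∧ currentFace w c n = j + 2 := by
  induction n with
  | zero => exact .inl rfl
  | succ n ih =>
    by_cases h : w[n]? = some c
    · exact .inr ⟨n, by omega, h, if_pos h⟩
    · rw [show currentFace w c (n + 1) = currentFace w c n from if_neg h]
      exact ih.imp_right fun ⟨j, hj, hj'⟩ => ⟨j, by omega, hj'⟩

theorem currentFace_lt (c : Bool) (n : ℕ) : currentFace w c n < w.length + 2 := by
  rcases currentFace_eq_or (w := w) c n with h | ⟨j, -, hj, h⟩
  · rw [h]; split_ifs <;> omega
  · have := getElem?_lt hj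
    omega

theorem currentFace_succ_of_eq {c : Bool} {i : ℕ} (h : w[i]? = some c) :
    currentFace w c (i + 1) = i + 2 := if_pos h

theorem currentFace_succ_of_ne {c : Bool} {i : ℕ} (h : w[i]? ≠ some c) :
    currentFace w c (i + 1) = currentFace w c i := if_neg h

/-- A face number determines its side: 0 is upper, 1 is lower, and `j + 2` lies on the side `w[j]`.
-/
theorem currentFace_side_unique {c c' : Bool} {n n' : ℕ}
    (h : currentFace w c n = currentFace w c' n') : c = c' := by
  rcases currentFace_eq_or (w := w) c n with h1 | ⟨j, -, hj, h1⟩ <;>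
    rcases currentFace_eq_or (w := w) c' n' with h2 | ⟨j', -, hj', h2⟩ <;> rw [h1, h2] at h
  · cases c <;> cases c' <;> simp_all
  · split_ifs at h; omega
  · split_ifs at h; omega
  · obtain rfl : j = j' := by omega
    rw [hj] at hj'
    exact Option.some.inj hj'

/-- With `currentFace_le`, this makes `n + 1` the larger of the two current face numbers, so the
pair of current faces determines `n`. -/
theorem exists_currentFace_eq {n : ℕ} (hn : n ≤ w.length) : ∃ c, currentFace w c n = n + 1 := by
  cases n with
  | zero => exact ⟨false, rfl⟩
  | succ i => exact ⟨w[i], currentFace_succ_of_eq (by simp)⟩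

/-- Between consecutive leaves of a side no pending edge starts a new face there. -/
theorem Link.currentFace_eq {c : Bool} {a b n : ℕ} (h : Link w c a b) (h1 : a ≤ n) (h2 : n < b) :
    currentFace w c n = currentFace w c a := by
  induction n, h1 using Nat.le_induction with
  | base => rfl
  | succ n hn ih =>
    rw [currentFace_succ_of_ne, ih (by omega)]
    exact fun h3 => h.2.2.2.2 (n + 1) (by omega) h2 (.inr (.inr ⟨n, rfl, h3⟩))

theorem Link.eq_right {c : Bool} {a b b' : ℕ} (h : Link w c a b) (h' : Link w c a b') : b = b' := by
  by_contra hne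
  rcases Nat.lt_or_gt_of_ne hne with h1 | h1
  · exact h'.2.2.2.2 b h.1 h1 h.2.2.2.1
  · exact h.2.2.2.2 b' h'.1 h1 h'.2.2.2.1

theorem Link.eq_left {c : Bool} {a a' b : ℕ} (h : Link w c a b) (h' : Link w c a' b) : a = a' := by
  by_contra hne
  rcases Nat.lt_or_gt_of_ne hne with h1 | h1
  · exact h.2.2.2.2 a' h1 h'.1 h'.2.2.1
  · exact h'.2.2.2.2 a h1 h.1 h.2.2.1

theorem exists_link_right {c : Bool} {a : ℕ} (h : Side w c a) (ha : a ≤ w.length) :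
    ∃ b, Link w c a b := by
  classical
  have hex : ∃ b, a < b ∧ Side w c b := ⟨w.length + 1, by omega, .inr (.inl rfl)⟩
  refine ⟨Nat.find hex, (Nat.find_spec hex).1, Nat.find_min' hex ⟨by omega, .inr (.inl rfl)⟩, h,
    (Nat.find_spec hex).2, fun x h1 h2 h3 => Nat.find_min hex h2 ⟨h1, h3⟩⟩

theorem exists_link_left {c : Bool} {b : ℕ} (h : Side w c b) (hb : 0 < b) (hb' : b ≤ w.length + 1) :
    ∃ a, Link w c a b := by
  classical
  -- Searching downwards from `b - 1`, the least `n` gives the nearest leaf to the left.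
  have hex : ∃ n, n < b ∧ Side w c (b - 1 - n) := ⟨b - 1, by omega, .inl (by omega)⟩
  have h1 := Nat.find_spec hex
  refine ⟨b - 1 - Nat.find hex, by omega, hb', h1.2, h, fun x h2 h3 h4 => ?_⟩
  refine Nat.find_min hex (m := b - 1 - x) (by omega) ⟨by omega, ?_⟩
  rwa [show b - 1 - (b - 1 - x) = x by omega]

theorem side_succ_iff {c : Bool} {i : ℕ} (hi : i < w.length) :
    Side w c (i + 1) ↔ w[i]? = some c := by
  constructor
  · rintro (h | h | ⟨j, h, h'⟩)
    · omega
    · omega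
    · obtain rfl : i = j := by omega
      exact h'
  · exact fun h => .inr (.inr ⟨i, rfl, h⟩)

/-- If leaves are attached on both sides, no two leaves are consecutive on both sides. -/
theorem Link.not_side (hw : ∀ c, c ∈ w) {c c' : Bool} (hc : c ≠ c') {a b : ℕ}
    (h : Link w c a b) : ¬ (Side w c' a ∧ Side w c' b) := by
  have key : ∀ a, Side w c a → Side w c' a → a = 0 ∨ a = w.length + 1 := by
    rintro a (h1 | h1 | ⟨i, h1, h1'⟩) (h2 | h2 | ⟨j, h2, h2'⟩)
    any_goals omega
    obtain rfl : i = j := by omega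
    rw [h1'] at h2'
    exact absurd (Option.some.inj h2') hc
  rintro ⟨ha, hb⟩
  obtain ⟨i, hi⟩ := List.mem_iff_getElem?.1 (hw c)
  have := getElem?_lt hi
  have h1 := h.1
  have h2 := h.2.1
  rcases key a h.2.2.1 ha with h3 | h3 <;> rcases key b h.2.2.2.1 hb with h4 | h4
  any_goals omega
  exact h.2.2.2.2 (i + 1) (by omega) (by omega) (.inr (.inr ⟨i, rfl, hi⟩))

theorem onSide_iff {c : Bool} {a : Fin (w.length + 2)} : OnSide w c a ↔ Side w c a.val := by
  unfold OnSide Side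
  refine or_congr Iff.rfl (or_congr Iff.rfl ⟨?_, ?_⟩)
  · rintro ⟨i, h, h'⟩
    exact ⟨i, h, by simp [← h']⟩
  · rintro ⟨i, h, h'⟩
    exact ⟨⟨i, getElem?_lt h'⟩, h, (List.getElem?_eq_some_iff.1 h').2⟩

theorem edgeRel_inr_inr {a b : Fin (w.length + 2)} :
    EdgeRel w (Sum.inr a) (Sum.inr b) ↔ ∃ c, Link w c a.val b.val := by
  simp only [EdgeRel, onSide_iff, Link]
  constructor
  · rintro ⟨h, c, h1, h2, h3⟩
    exact ⟨c, h, by omega, h1, h2, fun x hx hx' => h3 ⟨x, by omega⟩ hx hx'⟩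
  · rintro ⟨c, h, -, h1, h2, h3⟩
    exact ⟨h, c, h1, h2, fun x hx hx' => h3 x hx hx'⟩

theorem adj_inr_inr {a b : Fin (w.length + 2)} : (graph w).Adj (Sum.inr a) (Sum.inr b) ↔
    ∃ c, Link w c a.val b.val ∨ Link w c b.val a.val := by
  rw [graph, SimpleGraph.fromRel_adj, edgeRel_inr_inr, edgeRel_inr_inr, ← exists_or]
  refine and_iff_right_of_imp ?_
  rintro ⟨c, h | h⟩ h1
  · exact h.1.ne (congrArg Fin.val (Sum.inr.inj h1))
  · exact h.1.ne (congrArg Fin.val (Sum.inr.inj h1)).symm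

theorem adj_inl_inl {i j : Fin w.length} : (graph w).Adj (Sum.inl i) (Sum.inl j) ↔
    j.val = i.val + 1 ∨ i.val = j.val + 1 := by
  rw [graph, SimpleGraph.fromRel_adj]
  refine and_iff_right_of_imp ?_
  rintro h h1
  rw [Sum.inl.inj h1] at h
  rcases h with h | h <;> simp [EdgeRel] at h

theorem adj_inl_inr {i : Fin w.length} {a : Fin (w.length + 2)} :
    (graph w).Adj (Sum.inl i) (Sum.inr a) ↔ a.val = i.val + 1 ∨ (i.val = 0 ∧ a.val = 0) ∨
      (i.val + 1 = w.length ∧ a.val = w.length + 1) := by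
  rw [graph, SimpleGraph.fromRel_adj]
  simp [EdgeRel]

theorem adj_inr_inl {i : Fin w.length} {a : Fin (w.length + 2)} :
    (graph w).Adj (Sum.inr a) (Sum.inl i) ↔ a.val = i.val + 1 ∨ (i.val = 0 ∧ a.val = 0) ∨
      (i.val + 1 = w.length ∧ a.val = w.length + 1) := by
  rw [SimpleGraph.adj_comm, adj_inl_inr]

variable (w)

/-- The inner face on the side `c` behind the first `n` spine vertices. -/
def face (c : Bool) (n : ℕ) : Option (Fin (w.length + 2)) :=
  some ⟨currentFace w c n, currentFace_lt c n⟩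

open Classical in
/-- The face on the left of the dart from one vertex to another one. -/
noncomputable def leftFace : Vertex w.length → Vertex w.length → Option (Fin (w.length + 2))
  | Sum.inl i, Sum.inl j => if i < j then face w true j else face w false i
  | Sum.inl i, Sum.inr a =>
    if a.val = 0 then face w false 0 else if a.val = w.length + 1 then face w true w.length
    else if w[i.val]? = some true then face w true i else face w false (i + 1)
  | Sum.inr a, Sum.inl i =>
    if a.val = 0 then face w true 0 else if a.val = w.length + 1 then face w false w.length
    else if w[i.val]? = some true then face w true (i + 1) else face w false i
  | Sum.inr a, Sum.inr b =>
    -- For consecutive leaves this test recognises the upper arc, by `Link.not_side`. Rightward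
    -- darts on the upper arc have the outer face on their left, on the lower arc an inner face.
    if Side w true a ∧ Side w true b then if a < b then none else face w true b
    else if a < b then face w false a else none

/-- The vertices of the horizontal path. -/
def pathVertex (n : ℕ) : Vertex w.length :=
  if h : 0 < n ∧ n ≤ w.length then Sum.inl ⟨n - 1, by omega⟩
  else if n = 0 then Sum.inr 0 else Sum.inr (Fin.last _)

variable {w}

theorem pathVertex_zero : pathVertex w 0 = Sum.inr 0 := by simp [pathVertex]

theorem pathVertex_succ (i : Fin w.length) : pathVertex w (i + 1) = Sum.inl i := by
  simp [pathVertex, i.2]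

theorem pathVertex_last : pathVertex w (w.length + 1) = Sum.inr (Fin.last _) := by
  simp [pathVertex]

theorem face_injective {c c' : Bool} {n n' : ℕ} :
    face w c n = face w c' n' ↔ currentFace w c n = currentFace w c' n' := by
  simp [face]

theorem adj_pathVertex (hw : w ≠ []) {n : ℕ} (hn : n ≤ w.length) :
    (graph w).Adj (pathVertex w n) (pathVertex w (n + 1)) := by
  have := List.length_pos_iff.2 hw
  rcases n with _ | i
  · rw [pathVertex_zero, pathVertex_succ ⟨0, this⟩, adj_inr_inl]
    simp
  · rw [pathVertex_succ ⟨i, hn⟩]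
    by_cases hi : i + 1 < w.length
    · rw [pathVertex_succ ⟨i + 1, hi⟩, adj_inl_inl]
      simp
    · have h : i + 1 = w.length := by omega
      rw [h, pathVertex_last, adj_inl_inr]
      simp [h]

theorem leftFace_pathVertex (hw : w ≠ []) {n : ℕ} (hn : n ≤ w.length) :
    leftFace w (pathVertex w n) (pathVertex w (n + 1)) = face w true n ∧
      leftFace w (pathVertex w (n + 1)) (pathVertex w n) = face w false n := by
  have := List.length_pos_iff.2 hw
  rcases n with _ | i
  · rw [pathVertex_zero, pathVertex_succ ⟨0, this⟩]
    simp [leftFace]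
  · rw [pathVertex_succ ⟨i, hn⟩]
    by_cases hi : i + 1 < w.length
    · rw [pathVertex_succ ⟨i + 1, hi⟩]
      simp [leftFace, Fin.lt_def]
    · have h : i + 1 = w.length := by omega
      rw [h, pathVertex_last]
      simp [leftFace]

theorem leftFace_link_true {a b : Fin (w.length + 2)} (h : Link w true a b) :
    leftFace w (Sum.inr a) (Sum.inr b) = none ∧
      leftFace w (Sum.inr b) (Sum.inr a) = face w true a := by
  have h1 : ¬ b < a := fun h2 => absurd h.1 (not_lt_of_gt h2)
  have h2 : a < b := h.1
  simp [leftFace, h.2.2.1, h.2.2.2.1, h1, h2]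

theorem leftFace_link_false (hw : ∀ c, c ∈ w) {a b : Fin (w.length + 2)} (h : Link w false a b) :
    leftFace w (Sum.inr a) (Sum.inr b) = face w false a ∧
      leftFace w (Sum.inr b) (Sum.inr a) = none := by
  have h1 : ¬ b < a := fun h2 => absurd h.1 (not_lt_of_gt h2)
  have h2 : a < b := h.1
  have h3 := h.not_side hw (c' := true) (by simp)
  simp only [leftFace]
  rw [if_neg h3, if_neg (show ¬ (Side w true b ∧ Side w true a) from fun h4 => h3 h4.symm),
    if_pos h2, if_neg h1]
  exact ⟨rfl, rfl⟩

end CaterpillarHalin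

/-! ### The rotation at each vertex -/

/-- A vertex with three neighbours, in the order of the rotation. -/
theorem SimpleGraph.exists_star_of_neighbors {V Φ : Type*} {G : SimpleGraph V} (f : V → V → Φ)
    {v x y z : V} (h : ∀ u, G.Adj v u ↔ u = x ∨ u = y ∨ u = z)
    (hxy : f y v = f v x) (hyz : f z v = f v y) (hzx : f x v = f v z)
    (h1 : f v x ≠ f v y) (h2 : f v y ≠ f v z) (h3 : f v x ≠ f v z) :
    ∃ n : Fin 3 → G.Dart, (∀ i, (n i).fst = v) ∧ (∀ d : G.Dart, d.fst = v → ∃ i, n i = d) ∧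
      (∀ i, f (n (i + 1)).symm.fst (n (i + 1)).symm.snd = f (n i).fst (n i).snd) ∧
      Function.Injective ((fun d : G.Dart => f d.fst d.snd) ∘ n) := by
  refine ⟨![⟨(v, x), (h x).2 (.inl rfl)⟩, ⟨(v, y), (h y).2 (.inr (.inl rfl))⟩,
    ⟨(v, z), (h z).2 (.inr (.inr rfl))⟩], ?_, ?_, ?_, ?_⟩
  · intro i; fin_cases i <;> rfl
  · rintro ⟨⟨v', u⟩, hu⟩ hv
    change v' = v at hv
    subst hv
    rcases (h u).1 hu with rfl | rfl | rfl
    exacts [⟨0, rfl⟩, ⟨1, rfl⟩, ⟨2, rfl⟩]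
  · intro i; fin_cases i
    exacts [hxy, hyz, hzx]
  · intro i j hij
    fin_cases i <;> fin_cases j
    exacts [rfl, absurd hij h1, absurd hij h3, absurd hij.symm h1, rfl, absurd hij h2,
      absurd hij.symm h3, absurd hij.symm h2, rfl]

namespace CaterpillarHalin

variable {w : List Bool}

/-- The leaf at the spine vertex `i`. -/
def leaf (i : Fin w.length) : Vertex w.length := Sum.inr ⟨i + 1, by omega⟩

theorem adj_leaf (i : Fin w.length) : (graph w).Adj (Sum.inl i) (leaf i) :=
  adj_inl_inr.2 (.inl rfl)

theorem leftFace_leaf (i : Fin w.length) : leftFace w (Sum.inl i) (leaf i) =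
      (if w[i.val]? = some true then face w true i else face w false (i + 1)) ∧
    leftFace w (leaf i) (Sum.inl i) =
      (if w[i.val]? = some true then face w true (i + 1) else face w false i) := by
  have := i.2
  constructor <;> simp only [leftFace, leaf] <;> rw [if_neg (by omega), if_neg (by omega)]

theorem adj_inl_iff (hw : w ≠ []) (i : Fin w.length) (u : Vertex w.length) :
    (graph w).Adj (Sum.inl i) u ↔
      u = pathVertex w i ∨ u = pathVertex w (i + 2) ∨ u = leaf i := by
  have hi := i.2
  constructor
  · rcases u with j | a
    · rw [adj_inl_inl]
      rintro (h | h)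
      · rw [show i.val + 2 = j.val + 1 by omega, pathVertex_succ]
        simp
      · rw [h, pathVertex_succ]
        simp
    · rw [adj_inl_inr]
      rintro (h | ⟨h, h'⟩ | ⟨h, h'⟩)
      · exact .inr (.inr (congrArg Sum.inr (Fin.ext h)))
      · rw [h, pathVertex_zero]
        exact .inl (congrArg Sum.inr (Fin.ext h'))
      · rw [show i.val + 2 = w.length + 1 by omega, pathVertex_last]
        exact .inr (.inl (congrArg Sum.inr (Fin.ext h')))
  · have h1 := adj_pathVertex hw hi.le
    have h2 := adj_pathVertex hw (n := i + 1) hi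
    rw [pathVertex_succ] at h1 h2
    rintro (rfl | rfl | rfl)
    exacts [h1.symm, h2, adj_leaf i]

theorem adj_leaf_iff {i : Fin w.length} {c : Bool} (hc : w[i.val]? = some c)
    {p q : Fin (w.length + 2)} (hp : Link w c p (i + 1)) (hq : Link w c (i + 1) q)
    (u : Vertex w.length) :
    (graph w).Adj (leaf i) u ↔ u = Sum.inl i ∨ u = Sum.inr p ∨ u = Sum.inr q := by
  have hi := i.2
  constructor
  · rcases u with j | a
    · rw [leaf, adj_inr_inl]
      rintro (h | ⟨h, h'⟩ | ⟨h, h'⟩)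
      · simp only [add_left_inj] at h
        exact .inl (congrArg Sum.inl (Fin.ext h.symm))
      · simp at h'
      · simp only at h'
        omega
    · rw [leaf, adj_inr_inr]
      have key : ∀ c', Side w c' (i + 1) → c' = c := fun c' h => by
        rw [side_succ_iff hi, hc] at h
        exact (Option.some.inj h).symm
      rintro ⟨c', h | h⟩
      · obtain rfl := key c' h.2.2.1
        exact .inr (.inr (congrArg Sum.inr (Fin.ext (h.eq_right hq))))
      · obtain rfl := key c' h.2.2.2.1
        exact .inr (.inl (congrArg Sum.inr (Fin.ext (h.eq_left hp))))
  · rintro (rfl | rfl | rfl)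
    · exact (adj_leaf i).symm
    · exact adj_inr_inr.2 ⟨c, .inr hp⟩
    · exact adj_inr_inr.2 ⟨c, .inl hq⟩

theorem adj_first_iff (hw : w ≠ []) {q q' : Fin (w.length + 2)} (hq : Link w true 0 q)
    (hq' : Link w false 0 q') (u : Vertex w.length) :
    (graph w).Adj (Sum.inr 0) u ↔ u = pathVertex w 1 ∨ u = Sum.inr q ∨ u = Sum.inr q' := by
  have hpos := List.length_pos_iff.2 hw
  constructor
  · rcases u with j | a
    · rw [adj_inr_inl]
      rintro (h | ⟨h, h'⟩ | ⟨h, h'⟩)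
      · simp at h
      · rw [show 1 = j.val + 1 by omega, pathVertex_succ]
        simp
      · simp at h'
    · rw [adj_inr_inr]
      rintro ⟨_ | _, h | h⟩
      · exact .inr (.inr (congrArg Sum.inr (Fin.ext (h.eq_right hq'))))
      · exact absurd h.1 (Nat.not_lt_zero _)
      · exact .inr (.inl (congrArg Sum.inr (Fin.ext (h.eq_right hq))))
      · exact absurd h.1 (Nat.not_lt_zero _)
  · rintro (rfl | rfl | rfl)
    · have := adj_pathVertex hw (n := 0) (Nat.zero_le _)
      rwa [pathVertex_zero] at this
    · exact adj_inr_inr.2 ⟨_, .inl hq⟩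
    · exact adj_inr_inr.2 ⟨_, .inl hq'⟩

theorem adj_last_iff (hw : w ≠ []) {p p' : Fin (w.length + 2)} (hp : Link w true p (w.length + 1))
    (hp' : Link w false p' (w.length + 1)) (u : Vertex w.length) :
    (graph w).Adj (Sum.inr (Fin.last _)) u ↔
      u = pathVertex w w.length ∨ u = Sum.inr p' ∨ u = Sum.inr p := by
  have hpos := List.length_pos_iff.2 hw
  constructor
  · rcases u with j | a
    · have := j.2
      rw [adj_inr_inl, Fin.val_last]
      rintro (h | ⟨h, h'⟩ | ⟨h, h'⟩)
      · omega
      · omega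
      · have h2 := pathVertex_succ j
        rw [h] at h2
        exact .inl h2.symm
    · rw [adj_inr_inr]
      have ha : ¬ w.length + 1 < a.val := by omega
      rintro ⟨_ | _, h | h⟩
      · exact absurd h.1 ha
      · exact .inr (.inl (congrArg Sum.inr (Fin.ext (h.eq_left hp'))))
      · exact absurd h.1 ha
      · exact .inr (.inr (congrArg Sum.inr (Fin.ext (h.eq_left hp))))
  · rintro (rfl | rfl | rfl)
    · have := adj_pathVertex hw (n := w.length) le_rfl
      rw [pathVertex_last] at this
      exact this.symm
    · exact adj_inr_inr.2 ⟨_, .inr hp'⟩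
    · exact adj_inr_inr.2 ⟨_, .inr hp⟩

theorem exists_link_right' {c : Bool} {a : ℕ} (h : Side w c a) (ha : a ≤ w.length) :
    ∃ b : Fin (w.length + 2), Link w c a b := by
  obtain ⟨b, hb⟩ := exists_link_right h ha
  exact ⟨⟨b, by have := hb.2.1; omega⟩, hb⟩

theorem exists_link_left' {c : Bool} {b : ℕ} (h : Side w c b) (hb : 0 < b)
    (hb' : b ≤ w.length + 1) : ∃ a : Fin (w.length + 2), Link w c a b := by
  obtain ⟨a, ha⟩ := exists_link_left h hb hb'
  exact ⟨⟨a, by have := ha.1; omega⟩, ha⟩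

theorem face_ne_face {n n' : ℕ} {c c' : Bool} (hc : c ≠ c') : face w c n ≠ face w c' n' :=
  fun h => hc (currentFace_side_unique (face_injective.1 h))

theorem face_succ_ne {i : ℕ} {c : Bool} (h : w[i]? = some c) : face w c (i + 1) ≠ face w c i := by
  intro h1
  have h2 := face_injective.1 h1
  rw [currentFace_succ_of_eq h] at h2
  have := currentFace_le (w := w) c i
  omega

theorem face_succ_eq {i : ℕ} {c : Bool} (h : w[i]? ≠ some c) : face w c (i + 1) = face w c i :=
  face_injective.2 (currentFace_succ_of_ne h)

theorem face_ne_none (c : Bool) (n : ℕ) : face w c n ≠ none := Option.some_ne_none _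

theorem Link.face_eq {c : Bool} {a b n : ℕ} (h : Link w c a b) (h1 : a ≤ n) (h2 : n < b) :
    face w c a = face w c n := face_injective.2 (h.currentFace_eq h1 h2).symm

/-- The neighbours are listed counterclockwise in the drawing, in six cases: a spine vertex with
pending edge up or down, the two ends of the path, and the other leaves above and below. -/
theorem exists_star (hw : ∀ c, c ∈ w) (v : Vertex w.length) :
    ∃ n : Fin 3 → (graph w).Dart, (∀ i, (n i).fst = v) ∧
      (∀ d : (graph w).Dart, d.fst = v → ∃ i, n i = d) ∧
      (∀ i, leftFace w (n (i + 1)).symm.fst (n (i + 1)).symm.snd =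
        leftFace w (n i).fst (n i).snd) ∧
      Function.Injective ((fun d : (graph w).Dart => leftFace w d.fst d.snd) ∘ n) := by
  have hne : w ≠ [] := List.ne_nil_of_mem (hw true)
  have hbool : true ≠ false := by simp
  rcases v with i | a
  · have hi := i.2
    obtain ⟨hw1, hw2⟩ := leftFace_pathVertex hne hi.le
    obtain ⟨he1, he2⟩ := leftFace_pathVertex hne (n := i + 1) hi
    obtain ⟨hp1, hp2⟩ := leftFace_leaf i
    rw [pathVertex_succ] at hw1 hw2 he1 he2
    cases hc : w[i] with
    | true =>
      have hc1 : w[i.val]? = some true := by simpa using hc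
      have hc2 : w[i.val]? ≠ some false := by rw [hc1]; simp
      rw [if_pos hc1] at hp1 hp2
      apply SimpleGraph.exists_star_of_neighbors (leftFace w) (x := pathVertex w (i + 2))
        (y := leaf i) (z := pathVertex w i)
      · intro u; rw [adj_inl_iff hne]; tauto
      · rw [hp2, he1]
      · rw [hw1, hp1]
      · rw [he2, hw2, face_succ_eq hc2]
      · rw [he1, hp1]; exact face_succ_ne hc1
      · rw [hp1, hw2]; exact face_ne_face hbool
      · rw [he1, hw2]; exact face_ne_face hbool
    | false =>
      have hc1 : w[i.val]? = some false := by simpa using hc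
      have hc2 : w[i.val]? ≠ some true := by rw [hc1]; simp
      rw [if_neg hc2] at hp1 hp2
      apply SimpleGraph.exists_star_of_neighbors (leftFace w) (x := pathVertex w (i + 2))
        (y := pathVertex w i) (z := leaf i)
      · intro u; rw [adj_inl_iff hne]; tauto
      · rw [hw1, he1, face_succ_eq hc2]
      · rw [hp2, hw2]
      · rw [he2, hp1]
      · rw [he1, hw2]; exact face_ne_face hbool
      · rw [hw2, hp1]; exact (face_succ_ne hc1).symm
      · rw [he1, hp1]; exact face_ne_face hbool
  · by_cases ha0 : a = 0
    · subst ha0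
      obtain ⟨q, hq⟩ := exists_link_right' (w := w) (c := true) (.inl rfl) (Nat.zero_le _)
      obtain ⟨q', hq'⟩ := exists_link_right' (w := w) (c := false) (.inl rfl) (Nat.zero_le _)
      obtain ⟨he1, he2⟩ := leftFace_pathVertex hne (Nat.zero_le w.length)
      obtain ⟨hq1, hq2⟩ := leftFace_link_true (a := 0) hq
      obtain ⟨hq1', hq2'⟩ := leftFace_link_false hw (a := 0) hq'
      rw [pathVertex_zero] at he1 he2
      apply SimpleGraph.exists_star_of_neighbors (leftFace w) (adj_first_iff hne hq hq')
      · rw [hq2, he1]; rfl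
      · rw [hq2', hq1]
      · rw [he2, hq1']; rfl
      · rw [he1, hq1]; exact face_ne_none _ _
      · rw [hq1, hq1']; exact (face_ne_none _ _).symm
      · rw [he1, hq1']; exact face_ne_face hbool
    by_cases hal : a = Fin.last _
    · subst hal
      obtain ⟨p, hp⟩ := exists_link_left' (w := w) (c := true) (.inr (.inl rfl)) (Nat.succ_pos _)
        le_rfl
      obtain ⟨p', hp'⟩ := exists_link_left' (w := w) (c := false) (.inr (.inl rfl))
        (Nat.succ_pos _) le_rfl
      obtain ⟨he1, he2⟩ := leftFace_pathVertex hne (le_refl w.length)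
      obtain ⟨hp1, hp2⟩ := leftFace_link_true (b := Fin.last _) hp
      obtain ⟨hp1', hp2'⟩ := leftFace_link_false hw (b := Fin.last _) hp'
      rw [pathVertex_last] at he1 he2
      rw [hp.face_eq (Nat.lt_succ_iff.1 hp.1) (Nat.lt_succ_self _)] at hp2
      rw [hp'.face_eq (Nat.lt_succ_iff.1 hp'.1) (Nat.lt_succ_self _)] at hp1'
      apply SimpleGraph.exists_star_of_neighbors (leftFace w) (adj_last_iff hne hp hp')
      · rw [hp1', he2]
      · rw [hp1, hp2']
      · rw [he1, hp2]
      · rw [he2, hp2']; exact face_ne_none _ _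
      · rw [hp2', hp2]; exact (face_ne_none _ _).symm
      · rw [he2, hp2]; exact face_ne_face hbool.symm
    have ha1 : a.val ≠ 0 := fun h => ha0 (Fin.ext h)
    have ha2 : a.val ≠ w.length + 1 := fun h => hal (Fin.ext h)
    have ha3 : a.val - 1 < w.length := by omega
    obtain ⟨i, hi⟩ : ∃ i : Fin w.length, Sum.inr a = leaf i :=
      ⟨⟨a.val - 1, ha3⟩, congrArg Sum.inr (Fin.ext (Nat.succ_pred_eq_of_ne_zero ha1).symm)⟩
    rw [hi]
    clear hi ha1 ha2 ha3 ha0 hal a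
    have hi := i.2
    obtain ⟨hp1, hp2⟩ := leftFace_leaf i
    obtain ⟨c, hc⟩ : ∃ c, w[i.val]? = some c := ⟨w[i], by simp⟩
    have hs : Side w c (i + 1) := (side_succ_iff hi).2 hc
    obtain ⟨p, hp⟩ := exists_link_left' hs (Nat.succ_pos _) (by omega)
    obtain ⟨q, hq⟩ := exists_link_right' hs hi
    have hpf := hp.face_eq (Nat.lt_succ_iff.1 hp.1) (Nat.lt_succ_self _)
    cases c with
    | true =>
      rw [if_pos hc] at hp1 hp2
      obtain ⟨h1, h2⟩ := leftFace_link_true (b := ⟨i + 1, by omega⟩) hp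
      obtain ⟨h3, h4⟩ := leftFace_link_true (a := ⟨i + 1, by omega⟩) hq
      change leftFace w _ (leaf i) = _ at h1 h4
      change leftFace w (leaf i) _ = _ at h2 h3
      apply SimpleGraph.exists_star_of_neighbors (leftFace w) (x := Sum.inl i) (y := Sum.inr q)
        (z := Sum.inr p)
      · intro u; rw [adj_leaf_iff hc hp hq]; tauto
      · rw [h4, hp2]
      · rw [h1, h3]
      · rw [hp1, h2, hpf]
      · rw [hp2, h3]; exact face_ne_none _ _
      · rw [h3, h2]; exact (face_ne_none _ _).symm
      · rw [hp2, h2, hpf]; exact face_succ_ne hc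
    | false =>
      have hc2 : w[i.val]? ≠ some true := by rw [hc]; simp
      rw [if_neg hc2] at hp1 hp2
      obtain ⟨h1, h2⟩ := leftFace_link_false hw (b := ⟨i + 1, by omega⟩) hp
      obtain ⟨h3, h4⟩ := leftFace_link_false hw (a := ⟨i + 1, by omega⟩) hq
      change leftFace w _ (leaf i) = _ at h1 h4
      change leftFace w (leaf i) _ = _ at h2 h3
      apply SimpleGraph.exists_star_of_neighbors (leftFace w) (x := Sum.inl i) (y := Sum.inr p)
        (z := Sum.inr q)
      · intro u; rw [adj_leaf_iff hc hp hq]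
      · rw [h1, hp2, hpf]
      · rw [h4, h2]
      · rw [hp1, h3]
      · rw [hp2, h2]; exact face_ne_none _ _
      · rw [h2, h3]; exact (face_ne_none _ _).symm
      · rw [hp2, h3]; exact (face_succ_ne hc).symm

end CaterpillarHalin

/-! ### Edges and the pairs of faces they separate -/

namespace CaterpillarHalin

variable {w : List Bool}

/-- The edges of the caterpillar-Halin graph with the two faces that they separate. -/
inductive EdgeFaces (w : List Bool) :
    Sym2 (Vertex w.length) → Sym2 (Option (Fin (w.length + 2))) → Prop
  | path (n : ℕ) (hn : n ≤ w.length) :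
      EdgeFaces w s(pathVertex w n, pathVertex w (n + 1)) s(face w true n, face w false n)
  | pendant (i : Fin w.length) (c : Bool) (hc : w[i.val]? = some c) :
      EdgeFaces w s(Sum.inl i, leaf i) s(face w c i, face w c (i + 1))
  | outer (c : Bool) (a b : Fin (w.length + 2)) (h : Link w c a b) :
      EdgeFaces w s(Sum.inr a, Sum.inr b) s(none, face w c a)

theorem edgeFaces_path_of_le (hw : w ≠ []) {n : ℕ} (hn : n ≤ w.length) :
    EdgeFaces w s(pathVertex w n, pathVertex w (n + 1))
      s(leftFace w (pathVertex w n) (pathVertex w (n + 1)),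
        leftFace w (pathVertex w (n + 1)) (pathVertex w n)) := by
  rw [(leftFace_pathVertex hw hn).1, (leftFace_pathVertex hw hn).2]
  exact .path n hn

theorem edgeFaces_pendant (i : Fin w.length) :
    EdgeFaces w s(Sum.inl i, leaf i)
      s(leftFace w (Sum.inl i) (leaf i), leftFace w (leaf i) (Sum.inl i)) := by
  rw [(leftFace_leaf i).1, (leftFace_leaf i).2]
  split_ifs with h
  · exact .pendant i true h
  · rw [Sym2.eq_swap (a := face w false (i + 1))]
    refine .pendant i false ?_
    cases hc : w[i] with
    | true => exact absurd (by rw [← hc]; simp) h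
    | false => rw [← hc]; simp

theorem edgeFaces_outer (hw : ∀ c, c ∈ w) {c : Bool} {a b : Fin (w.length + 2)}
    (h : Link w c a b) :
    EdgeFaces w s(Sum.inr a, Sum.inr b)
      s(leftFace w (Sum.inr a) (Sum.inr b), leftFace w (Sum.inr b) (Sum.inr a)) := by
  cases c with
  | true =>
    rw [(leftFace_link_true h).1, (leftFace_link_true h).2]
    exact .outer true a b h
  | false =>
    rw [(leftFace_link_false hw h).1, (leftFace_link_false hw h).2, Sym2.eq_swap (b := none)]
    exact .outer false a b h

theorem edgeFaces_of_edgeRel (hw : ∀ c, c ∈ w) {u v : Vertex w.length} (h : EdgeRel w u v) :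
    EdgeFaces w s(u, v) s(leftFace w u v, leftFace w v u) := by
  have hne : w ≠ [] := List.ne_nil_of_mem (hw true)
  rcases u with i | a <;> rcases v with j | b
  · have h1 := edgeFaces_path_of_le hne (n := i + 1) i.2
    have h2 : j.val = i.val + 1 := h
    rw [← h2, pathVertex_succ, h2, pathVertex_succ] at h1
    exact h1
  · rcases h with h | ⟨h, h'⟩ | ⟨h, h'⟩
    · have h1 : (Sum.inr b : Vertex w.length) = leaf i := congrArg Sum.inr (Fin.ext h)
      rw [h1]
      exact edgeFaces_pendant i
    · have h1 := edgeFaces_path_of_le hne (n := 0) (Nat.zero_le _)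
      rw [← h, pathVertex_succ, h, pathVertex_zero] at h1
      obtain rfl : b = 0 := Fin.ext h'
      rwa [Sym2.eq_swap, Sym2.eq_swap (a := leftFace w (Sum.inl i) _)]
    · have h1 := edgeFaces_path_of_le hne (n := i + 1) i.2
      obtain rfl : b = Fin.last _ := Fin.ext h'
      have h2 : pathVertex w (i + 1 + 1) = Sum.inr (Fin.last _) := by rw [h, pathVertex_last]
      rwa [h2, pathVertex_succ] at h1
  · exact h.elim
  · obtain ⟨c, h⟩ := edgeRel_inr_inr.1 h
    exact edgeFaces_outer hw h

theorem edgeFaces_dart (hw : ∀ c, c ∈ w) (d : (graph w).Dart) :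
    EdgeFaces w d.edge s(leftFace w d.fst d.snd, leftFace w d.snd d.fst) := by
  rcases (SimpleGraph.fromRel_adj _ _ _).1 d.adj with ⟨-, h | h⟩
  · exact edgeFaces_of_edgeRel hw h
  · have := edgeFaces_of_edgeRel hw h
    rwa [Sym2.eq_swap, Sym2.eq_swap (a := leftFace w _ _)] at this

theorem face_eq_some_iff {c : Bool} {n : ℕ} {a : Fin (w.length + 2)} :
    face w c n = some a ↔ currentFace w c n = a := by
  simp [face, Fin.ext_iff]

theorem Side.currentFace_eq {c : Bool} {a : ℕ} (h : Side w c a) (h0 : a ≠ 0)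
    (ha : a ≤ w.length) : currentFace w c a = a + 1 := by
  rcases h with h | h | ⟨i, rfl, h⟩
  · omega
  · omega
  · exact currentFace_succ_of_eq h

theorem EdgeFaces.ne {e : Sym2 (Vertex w.length)} {x y : Option (Fin (w.length + 2))}
    (h : EdgeFaces w e s(x, y)) : x ≠ y := by
  have key : ∀ f, EdgeFaces w e f → ¬ f.IsDiag := by
    intro f h
    cases h with
    | path n hn => exact fun h => face_ne_face (by simp) (Sym2.mk_isDiag_iff.1 h)
    | pendant i c hc => exact fun h => face_succ_ne hc (Sym2.mk_isDiag_iff.1 h).symm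
    | outer c a b _ => exact fun h => face_ne_none _ _ (Sym2.mk_isDiag_iff.1 h).symm
  exact fun hxy => key _ h (Sym2.mk_isDiag_iff.2 hxy)

/-- Different edges do not separate the same faces. -/
theorem EdgeFaces.edge_unique {e e' : Sym2 (Vertex w.length)}
    {f f' : Sym2 (Option (Fin (w.length + 2)))} (h : EdgeFaces w e f) (h' : EdgeFaces w e' f')
    (hf : f = f') : e = e' := by
  rcases h with ⟨n, hn⟩ | ⟨i, c, hc⟩ | ⟨c, a, b, h⟩ <;>
    rcases h' with ⟨n', hn'⟩ | ⟨i', c', hc'⟩ | ⟨c', a', b', h'⟩ <;>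
    simp only [Sym2.eq_iff, face_injective, face_ne_none, (face_ne_none _ _).symm, false_and,
      and_false, or_false, true_and] at hf
  · rcases hf with ⟨h1, h2⟩ | ⟨h1, h2⟩
    · have h3 : n = n' := by
        have hb : ∀ c, currentFace w c n = currentFace w c n' := by
          rintro (_ | _)
          exacts [h2, h1]
        obtain ⟨c, hc⟩ := exists_currentFace_eq hn
        obtain ⟨c', hc'⟩ := exists_currentFace_eq hn'
        have h4 := currentFace_le (w := w) c n'
        have h5 := currentFace_le (w := w) c' n
        rw [← hb, hc] at h4
        rw [hb, hc'] at h5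
        omega
      rw [h3]
    · exact absurd (currentFace_side_unique h1) (by simp)
  -- A path edge separates faces on opposite sides, a pending edge two faces on the same side.
  · rcases hf with ⟨h1, h2⟩ | ⟨h1, h2⟩ <;>
      exact absurd ((currentFace_side_unique h1).trans (currentFace_side_unique h2).symm) (by simp)
  · rcases hf with ⟨h1, h2⟩ | ⟨h1, h2⟩
    · exact absurd ((currentFace_side_unique h1).symm.trans (currentFace_side_unique h2)) (by simp)
    · exact absurd ((currentFace_side_unique h1).symm.trans (currentFace_side_unique h2)) (by simp)
  · rw [currentFace_succ_of_eq hc, currentFace_succ_of_eq hc'] at hf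
    rcases hf with ⟨-, h2⟩ | ⟨h1, h2⟩
    · obtain rfl : i = i' := Fin.ext (by omega)
      rfl
    · have h3 := currentFace_le (w := w) c i
      have h4 := currentFace_le (w := w) c' i'
      omega
  · obtain rfl := currentFace_side_unique hf
    have ha : a.val ≤ w.length := Nat.lt_succ_iff.1 (h.1.trans_le h.2.1)
    have ha' : a'.val ≤ w.length := Nat.lt_succ_iff.1 (h'.1.trans_le h'.2.1)
    -- An inner face meets the outer one along the edge that starts at the leaf where the face
    -- begins: `u_0` for the faces 0 and 1, and `u_a` for the face `a + 1`.
    have hval : a.val = a'.val := by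
      have h0 := currentFace_le (w := w) c 0
      by_cases h1 : a.val = 0 <;> by_cases h2 : a'.val = 0
      · omega
      · rw [h1, h'.2.2.1.currentFace_eq h2 ha'] at hf
        omega
      · rw [h2, h.2.2.1.currentFace_eq h1 ha] at hf
        omega
      · rw [h'.2.2.1.currentFace_eq h2 ha', h.2.2.1.currentFace_eq h1 ha] at hf
        omega
    obtain rfl : a = a' := Fin.ext hval
    obtain rfl : b = b' := Fin.ext (h.eq_right h')
    rfl

theorem exists_outer_dart (hw : ∀ c, c ∈ w) (ψ : Fin (w.length + 2)) :
    ∃ d : (graph w).Dart, leftFace w d.fst d.snd = some ψ ∧ leftFace w d.snd d.fst = none := by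
  obtain ⟨c, a, ha, hs, hψ⟩ : ∃ c, ∃ a ≤ w.length, Side w c a ∧ currentFace w c a = ψ := by
    obtain ⟨ψ, hlt⟩ := ψ
    rcases ψ with _ | _ | i
    · exact ⟨true, 0, Nat.zero_le _, .inl rfl, rfl⟩
    · exact ⟨false, 0, Nat.zero_le _, .inl rfl, rfl⟩
    · have hi : i < w.length := by omega
      have hc : w[i]? = some w[i] := by simp
      exact ⟨w[i], i + 1, hi, (side_succ_iff hi).2 hc, currentFace_succ_of_eq hc⟩
  obtain ⟨b, hb⟩ := exists_link_right' hs ha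
  have hψ' : face w c a = some ψ := face_eq_some_iff.2 hψ
  have hb' : Link w c (⟨a, by omega⟩ : Fin (w.length + 2)) b := hb
  have hadj := adj_inr_inr.2 ⟨c, .inl hb'⟩
  cases c with
  | true =>
    have h := leftFace_link_true hb'
    exact ⟨⟨(_, _), hadj.symm⟩, h.2.trans hψ', h.1⟩
  | false =>
    have h := leftFace_link_false hw hb'
    exact ⟨⟨(_, _), hadj⟩, h.1.trans hψ', h.2⟩

/-- The edges off the outer cycle form the caterpillar, where `z` is obtained by summing `p` along
the horizontal path and then adding the value on the pending edge. -/
theorem exists_edgeCoboundary_eq_on_tree (hw : ∀ c, c ∈ w)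
    (p : (graph w).edgeSet → ZMod 2) :
    ∃ z : Vertex w.length → ZMod 2, ∀ d : (graph w).Dart, leftFace w d.fst d.snd ≠ none →
      leftFace w d.snd d.fst ≠ none → p d.toEdge = edgeCoboundary (graph w) z d.toEdge := by
  classical
  let P : Sym2 (Vertex w.length) → ZMod 2 := fun e =>
    if h : e ∈ (graph w).edgeSet then p ⟨e, h⟩ else 0
  have hP : ∀ d : (graph w).Dart, p d.toEdge = P d.edge := fun d => by
    simp only [P, dif_pos d.edge_mem]
    rfl
  let Z : ℕ → ZMod 2 := fun n => ∑ i ∈ Finset.range n, P s(pathVertex w i, pathVertex w (i + 1))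
  let z : Vertex w.length → ZMod 2
    | Sum.inl i => Z (i + 1)
    -- The end leaves lie on the path themselves and need no correction.
    | Sum.inr a => Z a + if h : 0 < a.val ∧ a.val ≤ w.length then
        P s(Sum.inl ⟨a.val - 1, by omega⟩, Sum.inr a) else 0
  have hz : ∀ n ≤ w.length + 1, z (pathVertex w n) = Z n := by
    intro n hn
    rcases n with _ | n
    · simp [pathVertex_zero, z]
    rcases Nat.lt_or_ge n w.length with h | h
    · rw [pathVertex_succ ⟨n, h⟩]
    · rw [show n = w.length by omega, pathVertex_last]
      simp [z]
  have hleaf : ∀ i : Fin w.length, z (leaf i) = Z (i + 1) + P s(Sum.inl i, leaf i) := by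
    intro i
    simp [z, leaf, i.2]
  refine ⟨z, fun d h1 h2 => ?_⟩
  have h := edgeFaces_dart hw d
  have hcob : ∀ u v, d.edge = s(u, v) → edgeCoboundary (graph w) z d.toEdge = z u + z v := by
    intro u v huv
    change Sym2.lift _ d.edge = _
    rw [huv]
    rfl
  rw [hP]
  generalize hf : s(leftFace w d.fst d.snd, leftFace w d.snd d.fst) = f at h
  generalize he : d.edge = e at h
  cases h with
  | path n hn =>
    rw [hcob _ _ he, hz n (by omega), hz (n + 1) (by omega)]
    simp only [Z, Finset.sum_range_succ]
    exact (CharTwo.add_cancel_left _ _).symm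
  | pendant i c hc =>
    rw [hcob _ _ he, hleaf]
    exact (CharTwo.add_cancel_left _ _).symm
  | outer c a b h =>
    rw [Sym2.eq_iff] at hf
    rcases hf with ⟨h3, -⟩ | ⟨-, h3⟩
    exacts [absurd h3 h1, absurd h3 h2]

/-- The faces of the plane drawing of the caterpillar-Halin graph. -/
noncomputable def faceLabelling (hw : ∀ c, c ∈ w) :
    FaceLabelling (graph w) (Fin (w.length + 2)) where
  left d := leftFace w d.fst d.snd
  star := exists_star hw
  left_inj d d' h h' := by
    have h1 := edgeFaces_dart hw d
    have h2 := edgeFaces_dart hw d'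
    have h3 : d.edge = d'.edge := h1.edge_unique h2 (by
      change leftFace w d.snd d.fst = leftFace w d'.snd d'.fst at h'
      rw [h, h'])
    rcases (SimpleGraph.dart_edge_eq_iff d d').1 h3 with rfl | rfl
    · rfl
    · exact absurd h h1.ne
  outer := exists_outer_dart hw
  forest := exists_edgeCoboundary_eq_on_tree hw

end CaterpillarHalin

/-! ### The inner dual and its cliques -/

namespace CaterpillarHalin

variable {w : List Bool}

theorem innerDual_adj_iff (hw : ∀ c, c ∈ w) (a b : Fin (w.length + 2)) :
    (faceLabelling hw).toCubicPlaneMap.innerDual.Adj a b ↔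
      ∃ e, EdgeFaces w e s(some a, some b) := by
  have hne : w ≠ [] := List.ne_nil_of_mem (hw true)
  have key : ∀ d : (graph w).Dart,
      s(leftFace w d.fst d.snd, leftFace w d.snd d.fst) = s(some a, some b) →
      (faceLabelling hw).toCubicPlaneMap.innerDual.Adj a b := by
    intro d h
    rcases Sym2.eq_iff.1 h with ⟨h1, h2⟩ | ⟨h1, h2⟩
    · exact ⟨d, h1, h2⟩
    · exact ⟨d.symm, h2, h1⟩
  constructor
  · rintro ⟨d, h1, h2⟩
    have h := edgeFaces_dart hw d
    change leftFace w d.fst d.snd = some a at h1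
    change leftFace w d.snd d.fst = some b at h2
    rw [h1, h2] at h
    exact ⟨_, h⟩
  · rintro ⟨e, h⟩
    generalize hf : s(some a, some b) = f at h
    cases h with
    | path n hn =>
      refine key ⟨(_, _), adj_pathVertex hne hn⟩ ?_
      rw [hf]
      exact congrArg₂ _ (leftFace_pathVertex hne hn).1 (leftFace_pathVertex hne hn).2
    | pendant i c hc =>
      have h1 := leftFace_leaf i
      refine key ⟨(_, _), adj_leaf i⟩ ?_
      rw [hf]
      cases c with
      | true =>
        rw [if_pos hc, if_pos hc] at h1
        exact congrArg₂ _ h1.1 h1.2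
      | false =>
        have hc' : w[i.val]? ≠ some true := by rw [hc]; simp
        rw [if_neg hc', if_neg hc'] at h1
        exact (congrArg₂ (fun x y => s(x, y)) h1.1 h1.2).trans Sym2.eq_swap
    | outer c a b h =>
      rcases Sym2.eq_iff.1 hf with ⟨h, -⟩ | ⟨-, h⟩
      · exact absurd h (Option.some_ne_none _)
      · exact absurd h (Option.some_ne_none _)

/-- The face `i + 2` begins at a pending edge, across which lies the previous current face of that
side. Across the next path edge lies the current face of the other side, which has not changed.
Every later path edge on its boundary separates it from a face with a larger number. -/
theorem exists_edgeFaces_iff {a b : Fin (w.length + 2)} (hab : a < b) :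
    (∃ e, EdgeFaces w e s(some a, some b)) ↔
      (a.val = 0 ∧ b.val = 1) ∨ ∃ i c, b.val = i + 2 ∧ a.val = currentFace w c i := by
  have hab' : a.val < b.val := hab
  have hb := b.2
  constructor
  · rintro ⟨e, h⟩
    generalize hf : s(some a, some b) = f at h
    cases h with
    | path n hn =>
      obtain ⟨c, c', hcc, ha, hb'⟩ : ∃ c c' : Bool, c ≠ c' ∧ currentFace w c n = a.val ∧
          currentFace w c' n = b.val := by
        rcases Sym2.eq_iff.1 hf with ⟨h1, h2⟩ | ⟨h1, h2⟩
        · exact ⟨true, false, by simp, face_eq_some_iff.1 h1.symm, face_eq_some_iff.1 h2.symm⟩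
        · exact ⟨false, true, by simp, face_eq_some_iff.1 h1.symm, face_eq_some_iff.1 h2.symm⟩
      have hmax : b.val = n + 1 := by
        obtain ⟨x, hx⟩ := exists_currentFace_eq hn
        have h1 := currentFace_le (w := w) c' n
        have h2 : x = c ∨ x = c' := by cases x <;> cases c <;> cases c' <;> simp_all
        rcases h2 with rfl | rfl <;> omega
      rcases n with _ | i
      · exact .inl ⟨by omega, hmax⟩
      · refine .inr ⟨i, c, hmax, ?_⟩
        have h1 : w[i]? = some c' := by
          by_contra h1
          rw [currentFace_succ_of_ne h1] at hb'
          have h2 := currentFace_le (w := w) c' i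
          omega
        rw [← ha, currentFace_succ_of_ne]
        rw [h1]
        exact fun h => hcc (Option.some.inj h).symm
    | pendant i c hc =>
      have h3 := currentFace_succ_of_eq hc
      have h4 := currentFace_le (w := w) c i
      rcases Sym2.eq_iff.1 hf with ⟨h1, h2⟩ | ⟨h1, h2⟩
      · have h1 := face_eq_some_iff.1 h1.symm
        have h2 := face_eq_some_iff.1 h2.symm
        exact .inr ⟨i, c, by omega, h1.symm⟩
      · have h1 := face_eq_some_iff.1 h1.symm
        have h2 := face_eq_some_iff.1 h2.symm
        omega
    | outer c a b h =>
      rcases Sym2.eq_iff.1 hf with ⟨h, -⟩ | ⟨-, h⟩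
      · exact absurd h (Option.some_ne_none _)
      · exact absurd h (Option.some_ne_none _)
  · rintro (⟨ha, hb⟩ | ⟨i, c, hb', ha⟩)
    · have h := EdgeFaces.path (w := w) 0 (Nat.zero_le _)
      rw [(face_eq_some_iff (c := true) (n := 0)).2 ha.symm,
        (face_eq_some_iff (c := false) (n := 0)).2 hb.symm] at h
      exact ⟨_, h⟩
    · have hi : i < w.length := by omega
      by_cases hc : w[i]? = some c
      · have h := EdgeFaces.pendant (w := w) ⟨i, hi⟩ c hc
        rw [face_eq_some_iff.2 ha.symm,
          face_eq_some_iff.2 ((currentFace_succ_of_eq hc).trans hb'.symm)] at h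
        exact ⟨_, h⟩
      · have h := EdgeFaces.path (w := w) (i + 1) hi
        have hc' : w[i]? = some (!c) := by
          have h1 : w[i]? = some w[i] := by simp
          rw [h1] at hc ⊢
          cases c <;> cases h2 : w[i] <;> simp_all
        have h1 := face_eq_some_iff.2 ((currentFace_succ_of_eq hc').trans hb'.symm)
        have h2 := face_eq_some_iff.2 ((currentFace_succ_of_ne hc).trans ha.symm)
        cases c with
        | true =>
          change face w false (i + 1) = some b at h1
          rw [h1, h2] at h
          exact ⟨_, h⟩
        | false =>
          change face w true (i + 1) = some b at h1
          rw [h1, h2, Sym2.eq_swap (a := some b)] at h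
          exact ⟨_, h⟩

theorem innerDual_adj_iff_of_lt (hw : ∀ c, c ∈ w) {a b : Fin (w.length + 2)} (hab : a < b) :
    (faceLabelling hw).toCubicPlaneMap.innerDual.Adj a b ↔
      (a.val = 0 ∧ b.val = 1) ∨ ∃ i c, b.val = i + 2 ∧ a.val = currentFace w c i := by
  rw [innerDual_adj_iff, exists_edgeFaces_iff hab]

/-- Ordered by number, the face 0 has no smaller neighbour, the face 1 has one, and each of the
others has two, which are adjacent. The sum is `1 + 2 + 4 * w.length`. -/
theorem card_cliques (hw : ∀ c, c ∈ w) :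
    Nat.card {S : Finset (Fin (w.length + 2)) //
      S.Nonempty ∧ (faceLabelling hw).toCubicPlaneMap.innerDual.IsClique S} =
      4 * w.length + 3 := by
  classical
  set D := (faceLabelling hw).toCubicPlaneMap.innerDual with hD
  let low : Fin (w.length + 2) → Finset (Fin (w.length + 2)) := fun b =>
    Finset.univ.filter fun a => a < b ∧ D.Adj a b
  have hmem : ∀ a b, a ∈ low b ↔ a < b ∧ D.Adj a b := by simp [low]
  have hmem' : ∀ a b, a ∈ low b ↔
      (a.val = 0 ∧ b.val = 1) ∨ ∃ i c, b.val = i + 2 ∧ a.val = currentFace w c i := by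
    intro a b
    rw [hmem]
    constructor
    · rintro ⟨h1, h2⟩
      exact (innerDual_adj_iff_of_lt hw h1).1 h2
    · intro h
      have hab : a < b := by
        rcases h with ⟨h1, h2⟩ | ⟨i, c, h1, h2⟩
        · exact Fin.lt_def.2 (by omega)
        · have := currentFace_le (w := w) c i
          exact Fin.lt_def.2 (by omega)
      exact ⟨hab, (innerDual_adj_iff_of_lt hw hab).2 h⟩
  rw [SimpleGraph.card_nonempty_cliques D low hmem, Fin.sum_univ_succ, Fin.sum_univ_succ]
  · have h0 : low 0 = ∅ := by
      ext a
      rw [hmem']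
      simp
    have h1 : low (Fin.succ 0) = {0} := by
      ext a
      rw [hmem', Finset.mem_singleton, Fin.ext_iff]
      simp
    have h2 : ∀ i : Fin w.length, (low i.succ.succ).card = 2 := by
      intro i
      have : low i.succ.succ = {⟨currentFace w true i, currentFace_lt _ _⟩,
          ⟨currentFace w false i, currentFace_lt _ _⟩} := by
        ext a
        rw [hmem', Finset.mem_insert, Finset.mem_singleton, Fin.ext_iff, Fin.ext_iff]
        simp only [Fin.val_succ]
        constructor
        · rintro (⟨-, h⟩ | ⟨j, c, h, h'⟩)
          · omega
          · obtain rfl : i.val = j := by omega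
            cases c
            exacts [.inr h', .inl h']
        · rintro (h | h)
          · exact .inr ⟨i, true, rfl, h⟩
          · exact .inr ⟨i, false, rfl, h⟩
      rw [this, Finset.card_pair]
      intro h
      exact absurd (currentFace_side_unique (Fin.mk.inj h)) (by simp)
    simp only [h0, h1, h2, Finset.card_empty, Finset.card_singleton, Finset.sum_const,
      Finset.card_univ, Fintype.card_fin, smul_eq_mul]
    omega
  · intro b a ha a' ha' hne
    -- The two smaller neighbours of the face `i + 2` are separated by the path edge `i`, so they
    -- are adjacent.
    have key : ∀ i, i + 1 ≤ w.length + 1 → ∃ e, EdgeFaces w e s(face w true i, face w false i) :=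
      fun i hi => ⟨_, .path i (by omega)⟩
    rcases (hmem' _ _).1 ha with ⟨h1, h2⟩ | ⟨i, c, h1, h2⟩ <;>
      rcases (hmem' _ _).1 ha' with ⟨h1', h2'⟩ | ⟨i', c', h1', h2'⟩
    · exact absurd (Fin.ext (h1.trans h1'.symm)) hne
    · omega
    · omega
    · obtain rfl : i = i' := by omega
      have hb := b.2
      rw [hD, innerDual_adj_iff]
      have h := key i (by omega)
      have h3 := face_eq_some_iff.2 h2.symm
      have h4 := face_eq_some_iff.2 h2'.symm
      cases c <;> cases c'
      · exact absurd (Fin.ext (h2.trans h2'.symm)) hne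
      · rw [Sym2.eq_swap]; rwa [h3, h4] at h
      · rwa [h3, h4] at h
      · exact absurd (Fin.ext (h2.trans h2'.symm)) hne

/-! ### The final count -/

/-- The counts for a caterpillar-Halin graph with leaves on both sides. -/
theorem embeddingCount_graph (hw : ∀ c, c ∈ w) {T : SimpleGraph (Vertex w.length)}
    (hle : T ≤ graph w) (hT : T.IsTree) :
    embeddingCount (graph w) T 0 = 2 ∧ embeddingCount (graph w) T 1 = 8 * w.length + 6 := by
  -- With `ℓ = w.length` there are `2ℓ + 2` vertices, hence `3ℓ + 3` edges, and `ℓ + 2` inner faces.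
  have hE : Nat.card (Vertex w.length) + Fintype.card (Fin (w.length + 2)) =
      Nat.card (graph w).edgeSet + 1 := by
    have h1 := (faceLabelling hw).two_mul_card_edgeSet
    have h2 : Nat.card (Vertex w.length) = w.length + (w.length + 2) := by simp
    rw [Fintype.card_fin]
    omega
  refine ⟨(faceLabelling hw).toCubicPlaneMap.embeddingCount_zero hle hT hE, ?_⟩
  rw [(faceLabelling hw).toCubicPlaneMap.embeddingCount_one hle hT hE, card_cliques hw]
  ring

/-- Each of the `k - 2` middle runs has one extra leaf. -/
theorem length_directions {k : ℕ} (hk : 2 ≤ k) (m : Fin k → ℕ) :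
    (directions m).length + 2 = ∑ i, m i + k := by
  obtain ⟨n, rfl⟩ : ∃ n, k = n + 2 := ⟨k - 2, by omega⟩
  have h1 : (directions m).length = ∑ i, runLength m i := by
    rw [directions, List.length_flatMap, ← List.ofFn_eq_map, List.sum_ofFn]
    simp
  have h2 : ∀ i : Fin n, runLength m i.succ.castSucc = m i.succ.castSucc + 1 := by
    intro i
    rw [runLength, if_neg]
    simp only [Fin.val_castSucc, Fin.val_succ]
    omega
  have h3 : ∀ m : Fin (n + 2) → ℕ, ∑ i, m i =
      m 0 + ∑ i : Fin n, m i.succ.castSucc + m (Fin.last _) := fun m => by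
    rw [Fin.sum_univ_castSucc, Fin.sum_univ_succ]
    rfl
  rw [h1, h3, h3]
  simp only [h2, Finset.sum_add_distrib]
  simp [runLength]
  omega

/-- The run 0 goes up and the run 1 goes down, and both are nonempty. -/
theorem mem_directions {k : ℕ} (hk : 2 ≤ k) {m : Fin k → ℕ} (hm : ∀ i, 0 < m i) (c : Bool) :
    c ∈ directions m := by
  have h : ∀ i : Fin k, decide (Even i.val) ∈ directions m := fun i => by
    refine List.mem_flatMap.2 ⟨i, List.mem_finRange i, List.mem_replicate.2 ⟨?_, rfl⟩⟩
    have := hm i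
    unfold runLength
    split_ifs <;> omega
  cases c
  · simpa using h ⟨1, hk⟩
  · simpa using h ⟨0, by omega⟩

end CaterpillarHalin

theorem mainTheorem3 (k : ℕ) (hk : 2 ≤ k) (m : Fin k → ℕ) (hm : ∀ i, 0 < m i)
    (T : SimpleGraph (CaterpillarHalin.Vertex (CaterpillarHalin.directions m).length))
    (hle : T ≤ CaterpillarHalin.H m) (hT : T.IsTree) :
    embeddingCount (CaterpillarHalin.H m) T 0 = 2 ∧
    (embeddingCount (CaterpillarHalin.H m) T 1 : ℤ) = 8 * ((∑ i, (m i : ℤ)) + (k : ℤ)) - 10 := by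
  have h := CaterpillarHalin.embeddingCount_graph (CaterpillarHalin.mem_directions hk hm) hle hT
  refine ⟨h.1, ?_⟩
  have h1 := CaterpillarHalin.length_directions hk m
  have h2 : (((CaterpillarHalin.directions m).length + 2 : ℕ) : ℤ) =
      (∑ i, (m i : ℤ)) + (k : ℤ) := by
    rw [h1]; push_cast; rfl
  have h3 : embeddingCount (CaterpillarHalin.H m) T 1 =
      8 * (CaterpillarHalin.directions m).length + 6 := h.2
  -- What remains is `8ℓ + 6 = 8(ℓ + 2) - 10`.
  rw [h3, ← h2]
  push_cast
  ring
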